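/- **Setting.** Let $c>0$, let $g$ be a continuous 1-periodic function on $\mathbb R$ (functions on $(0,1)$ with periodic boundary conditions are identified with 1-periodic functions), and let $u$, continuous on $[0,\infty)\times\mathbb R$ and 1-periodic in $x$, be the viscosity solution of $$\min\big(u_t+c\,u_x,\;u-g(x)\big)=0\quad(t>0),\qquad u(0,x)=u_0(x).$$ Let $T\ge 0$ and $\ell\ge 2$, and assume that $u$ is *not shattering* on $[0,T]$: there are constants $p,L,c_0$ such that for every $t\in[0,T]$ the function $u(t,\cdot)$ is $L$-Lipschitz on $(0,1)$ and, outside a set of at most $p$ points of $(0,1)$ (which may depend on $t$), is of class $C^{\ell+1}$ with $(\ell+1)$-th derivative bounded by $c_0$. **Scheme.** Let $0=x_{1/2}<x_{3/2}<\dots<x_{N+1/2}=1$, $I_j=(x_{j-1/2},x_{j+1/2})$, $h_j=|I_j|$, $h=\max_j h_j$; let $k\ge 1$ and let $V_h$ be the space of functions whose restriction to each $I_j$ is a polynomial of degree at most $k$. Let $\Pi_h$ be the $L^2$ projection onto $V_h$, $(\cdot,\cdot)$ the $L^2(0,1)$ inner product, and, with periodic indices, $$\mathcal H(\phi,\varphi)=\sum_j\Big(\int_{I_j}c\,\phi\,\varphi_x\,dx-c\big(\phi^-_{j+1/2}\varphi^-_{j+1/2}-\phi^-_{j-1/2}\varphi^+_{j-1/2}\big)\Big).$$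 For $v\in V_h$ let $G^{RK}_{\Delta t}(v)=w\in V_h$ be given by $v_1,v_2,w\in V_h$ such that for all $\varphi\in V_h$ $$(v_1-v,\varphi)=\Delta t\,\mathcal H(v,\varphi),\quad \big(v_2-\tfrac34v-\tfrac14v_1,\varphi\big)=\tfrac{\Delta t}{4}\mathcal H(v_1,\varphi),\quad \big(w-\tfrac13v-\tfrac23v_2,\varphi\big)=\tfrac{2\Delta t}{3}\mathcal H(v_2,\varphi).$$ Let $\tilde g$ be either $\tilde g(x)=\max_{\theta\in[0,\Delta t]}g(x-c\theta)$ or $\tilde g(x)=\max\big(g(x),g(x-c\Delta t)\big)$. Put $u_h^0=\Pi_hu_0$, and let $u_h^{n+1}\in V_h$ be determined by $$u_h^{n+1}(x^j_\alpha)=\max\big(G^{RK}_{\Delta t}(u_h^n)(x^j_\alpha),\ \tilde g(x^j_\alpha)\big),\qquad j=1,\dots,N,\ \alpha=0,\dots,k,$$ where $x^j_0,\dots,x^j_k$ are the $k+1$ Gauss–Legendre points of $I_j$. **Theorem.** Given $k\ge1$, $c>0$ and a mesh-regularity constant $\rho$, there is $C_0>0$, depending only on $k,c,\rho$, such that for all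 data as above the following holds. 1. There is a constant $C\ge 0$ such that, for every mesh that is quasi-uniform in the sense that $h\le\rho\,h_j$ for all $j$, every $\Delta t$ satisfying the CFL condition $0<\Delta t\le C_0h$, either choice of $\tilde g$, and every $n\ge 0$ with $t_n:=n\Delta t\le T$, $$\|u_h^n-u(t_n,\cdot)\|_{L^2(0,1)}\le C\Big(h+\frac{h^3}{\Delta t^2}\Big)^{1/2}.$$ Here $C$ does not depend on $h$, the mesh, $\Delta t$, $n$, the choice of $\tilde g$, or $u_h$. 2. In particular, for every $\bar C_0>0$ there is a constant $C_1\ge0$, independent of the same quantities, such that if moreover $\Delta t/h\ge\bar C_0$, then $$\|u_h^n-u(t_n,\cdot)\|_{L^2(0,1)}\le C_1h^{1/2}.$$ -/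

import Mathlib

open Polynomial

noncomputable section

namespace ObstacleDG

/-! ### The obstacle problem `min (u_t + c u_x, u - g) = 0`, `u(0,·) = u₀`, 1-periodic in `x`

Functions on the interval `(0,1)` with periodic boundary conditions are represented by
1-periodic functions on `ℝ`. -/

/-- `u` is the (continuous, 1-periodic in space) viscosity solution of
`min (u_t + c u_x, u - g) = 0` for `t > 0`, with `u(0,·) = u₀`. A test function `φ` depends on the
pair `(t, x)`, so that `fderiv ℝ φ (t, x) (1, 0)` is `φ_t` and `fderiv ℝ φ (t, x) (0, 1)` is
`φ_x`. -/
structure IsViscositySolution (c : ℝ) (g u₀ : ℝ → ℝ) (u : ℝ → ℝ → ℝ) : Prop where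
  continuousOn : ContinuousOn (fun q : ℝ × ℝ => u q.1 q.2) {q | 0 ≤ q.1}
  periodic : ∀ t, 0 ≤ t → Function.Periodic (u t) 1
  initial : ∀ x, u 0 x = u₀ x
  subsolution : ∀ φ : ℝ × ℝ → ℝ, ContDiff ℝ 1 φ → ∀ t x : ℝ, 0 < t →
    IsLocalMax (fun q : ℝ × ℝ => u q.1 q.2 - φ q) (t, x) →
    min (fderiv ℝ φ (t, x) (1, 0) + c * fderiv ℝ φ (t, x) (0, 1)) (u t x - g x) ≤ 0
  supersolution : ∀ φ : ℝ × ℝ → ℝ, ContDiff ℝ 1 φ → ∀ t x : ℝ, 0 < t →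
    IsLocalMin (fun q : ℝ × ℝ => u q.1 q.2 - φ q) (t, x) →
    0 ≤ min (fderiv ℝ φ (t, x) (1, 0) + c * fderiv ℝ φ (t, x) (0, 1)) (u t x - g x)

/-- The class `C^{m}_{p,L,c₀}(0,1)`: functions that are `L`-Lipschitz on `(0,1)` and, away from
at most `p` points, of class `C^m` with `m`-th derivative bounded by `c₀`. -/
def PiecewiseRegular (m p : ℕ) (L c₀ : ℝ) (v : ℝ → ℝ) : Prop :=
  (∀ x ∈ Set.Ioo (0 : ℝ) 1, ∀ y ∈ Set.Ioo (0 : ℝ) 1, |v x - v y| ≤ L * |x - y|) ∧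
  ∃ S : Finset ℝ, S.card ≤ p ∧
    ContDiffOn ℝ (m : ℕ) v (Set.Ioo (0 : ℝ) 1 \ S) ∧
    ∀ x ∈ Set.Ioo (0 : ℝ) 1 \ S, |iteratedDeriv m v x| ≤ c₀

/-- The "no shattering" property on `[0,T]`, with regularity index `ℓ`. -/
def NoShattering (ℓ : ℕ) (T : ℝ) (u : ℝ → ℝ → ℝ) : Prop :=
  ∃ (p : ℕ) (L c₀ : ℝ), ∀ t ∈ Set.Icc 0 T, PiecewiseRegular (ℓ + 1) p L c₀ (u t)

/-- `g_s(x) = max_{θ ∈ [0,s]} g (x - c θ)`. -/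
def maxObstacle (c : ℝ) (g : ℝ → ℝ) (s x : ℝ) : ℝ :=
  sSup ((fun θ => g (x - c * θ)) '' Set.Icc 0 s)

/-- `max (g x, g (x - c s))`. -/
def twoPointObstacle (c : ℝ) (g : ℝ → ℝ) (s x : ℝ) : ℝ :=
  max (g x) (g (x - c * s))

/-! ### Meshes and the discontinuous Galerkin space -/

/-- A partition of `(0,1)` into `N` intervals `(node j, node (j+1))`. -/
structure Mesh (N : ℕ) where
  node : Fin (N + 1) → ℝ
  strictMono : StrictMono node
  node_zero : node 0 = 0
  node_last : node (Fin.last N) = 1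

namespace Mesh

variable {N : ℕ} (M : Mesh N)

/-- Left endpoint of the `j`-th cell. -/
def left (j : Fin N) : ℝ := M.node j.castSucc

/-- Right endpoint of the `j`-th cell. -/
def right (j : Fin N) : ℝ := M.node j.succ

/-- Length `h_j` of the `j`-th cell. -/
def width (j : Fin N) : ℝ := M.right j - M.left j

/-- Mesh size `h = max_j h_j`. -/
def h : ℝ := ⨆ j, M.width j

/-- Quasi-uniformity with constant `ρ`: `h ≤ ρ h_j` for all `j`. -/
def QuasiUniform (ρ : ℝ) : Prop := ∀ j, M.h ≤ ρ * M.width j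

end Mesh

/-- `V_h`: piecewise polynomials of degree at most `k`, one polynomial for each cell. -/
def DGSpace (N k : ℕ) : Set (Fin N → ℝ[X]) := {v | ∀ j, (v j).natDegree ≤ k}

variable {N : ℕ}

/-- The `L²` inner product `(v, φ)` of two piecewise polynomials. -/
def l2Inner (M : Mesh N) (v φ : Fin N → ℝ[X]) : ℝ :=
  ∑ j, ∫ x in (M.left j)..(M.right j), (v j).eval x * (φ j).eval x

/-- The `L²` inner product `(f, φ)` of a function with a piecewise polynomial. -/
def l2InnerFun (M : Mesh N) (f : ℝ → ℝ) (φ : Fin N → ℝ[X]) : ℝ :=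
  ∑ j, ∫ x in (M.left j)..(M.right j), f x * (φ j).eval x

/-- The `L²(0,1)` norm of `v - f`, for `v` piecewise polynomial. -/
def l2Error (M : Mesh N) (v : Fin N → ℝ[X]) (f : ℝ → ℝ) : ℝ :=
  √(∑ j, ∫ x in (M.left j)..(M.right j), ((v j).eval x - f x) ^ 2)

/-- The upwind form `𝓗(v, φ) = ∑_j 𝓗_j(v, φ)`, where
`𝓗_j(v, φ) = ∫_{I_j} c v φ_x - c (v⁻_{j+1/2} φ⁻_{j+1/2} - v⁻_{j-1/2} φ⁺_{j-1/2})`.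
The trace `v⁻_{j-1/2}` is taken from the cell `j - 1`; the index is cyclic (`Fin N`), which encodes
the periodic boundary condition. -/
def dgForm [NeZero N] (M : Mesh N) (c : ℝ) (v φ : Fin N → ℝ[X]) : ℝ :=
  ∑ j, ((∫ x in (M.left j)..(M.right j), c * (v j).eval x * (derivative (φ j)).eval x)
    - c * ((v j).eval (M.right j) * (φ j).eval (M.right j)
      - (v (j - 1)).eval (M.right (j - 1)) * (φ j).eval (M.left j)))

/-- `v` is the `L²` projection `Π_h f` of `f` onto `V_h`. -/
def IsL2Projection (M : Mesh N) (k : ℕ) (f : ℝ → ℝ) (v : Fin N → ℝ[X]) : Prop :=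
  v ∈ DGSpace N k ∧ ∀ φ ∈ DGSpace N k, l2Inner M v φ = l2InnerFun M f φ

/-- `w = G^{RK}_Δt (v)`: one step of the DG scheme with TVD-RK3 time stepping for
`v_t + c v_x = 0`. -/
def IsRKStep [NeZero N] (M : Mesh N) (k : ℕ) (c Δt : ℝ) (v w : Fin N → ℝ[X]) : Prop :=
  ∃ v₁ ∈ DGSpace N k, ∃ v₂ ∈ DGSpace N k, w ∈ DGSpace N k ∧
    (∀ φ ∈ DGSpace N k, l2Inner M (v₁ - v) φ = Δt * dgForm M c v φ) ∧
    (∀ φ ∈ DGSpace N k,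
      l2Inner M (v₂ - (3 / 4 : ℝ) • v - (1 / 4 : ℝ) • v₁) φ = Δt / 4 * dgForm M c v₁ φ) ∧
    (∀ φ ∈ DGSpace N k,
      l2Inner M (w - (1 / 3 : ℝ) • v - (2 / 3 : ℝ) • v₂) φ = 2 * Δt / 3 * dgForm M c v₂ φ)

/-- The `k+1` Gauss-Legendre points of the reference interval `(0,1)`: the roots of the Legendre
polynomial of degree `k+1` shifted to `(0,1)`. -/
def gaussPoints (k : ℕ) : Set ℝ := {r | aeval r (shiftedLegendre (k + 1)) = 0}

/-- The point of the `j`-th cell that corresponds to the point `r` of the reference interval. -/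
def Mesh.point (M : Mesh N) (j : Fin N) (r : ℝ) : ℝ := M.left j + M.width j * r

/-- `U n = u_h^n` is generated by the RKDG obstacle scheme with obstacle values `gt` taken at the
Gauss-Legendre points: `u_h^0 = Π_h u₀`, and `u_h^{n+1} ∈ V_h` satisfies
`u_h^{n+1} = max (G^{RK}_Δt (u_h^n), gt)` at all Gauss-Legendre points of all cells. -/
structure IsGaussRKDGScheme [NeZero N] (M : Mesh N) (k : ℕ) (c Δt : ℝ) (u₀ gt : ℝ → ℝ)
    (U : ℕ → Fin N → ℝ[X]) : Prop where
  initial : IsL2Projection M k u₀ (U 0)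
  mem : ∀ n, U (n + 1) ∈ DGSpace N k
  step : ∀ n, ∃ w, IsRKStep M k c Δt (U n) w ∧ ∀ j, ∀ r ∈ gaussPoints k,
    (U (n + 1) j).eval (M.point j r) = max ((w j).eval (M.point j r)) (gt (M.point j r))

end ObstacleDG

end

/-!
The stated bound is of first order in disguise: since `c Δt` is at most a cell width, `h` is at most
a multiple of `h³ / Δt²`, and after at most `T / Δt` steps it suffices that one step adds an error
of size `h ^ (3/2)` in `L²`. The error is measured as the distance of `u_h^n` to the
Gauss–Legendre interpolant of `u (t_n)`.

*The exact step.* A viscosity solution does not decrease along the characteristics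
`x = y + c t`, stays above the obstacle, and cannot grow along a characteristic while it is above
the obstacle. Hence `u (t + s, x) = max (u (t, x - c s)) (max_{θ ∈ [0, s]} g (x - c θ))`
(`IsViscositySolution.eq_max`). The numerical step has the same form, with the translation replaced
by the Runge–Kutta discontinuous Galerkin step.

*Stability.* Gauss–Legendre quadrature with `k + 1` points is exact up to degree `2 k + 1`
(`unitInt_eq_gauss_sum`), so the `L²` norm on `V_h` is a weighted Euclidean norm of the values at
the Gauss–Legendre points, and taking the maximum with the obstacle there is nonexpansive. The
upwind operator is dissipative and, under the CFL condition, of norm at most one after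
multiplication by `Δt`; the third order Runge–Kutta method is then a contraction by an energy
identity (`norm_rkMap_le`, `exists_cfl`).

*Consistency.* A step transports functions that are affine on a cell and its three left neighbours
exactly. Near a kink of `u (t_n)` or `u (t_{n+1})` the Lipschitz bound gives a local error `O(h)`,
on cells of total length `O(h)`. On a gap of length `δ` between kinks the second derivative is
`O(1 / δ)`, by a Landau–Kolmogorov inequality (`PiecewiseRegular.exists_tangentBound`), so the local
error is `O(h² / δ)`, with square integral `O(h⁴ / δ) = O(h³)` over the gap. The number of gaps is
bounded, and the sum of the squares is `O(h³)` (`Mesh.sum_width_mul_sq_le`). The maximum of the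
obstacle over two points, in place of the whole segment, costs no more: at a point where the
obstacle is active strictly inside the segment, `u (t_{n+1})` has a local minimum and both
functions are almost flat (`sub_max_obstacle_le_sq`).
-/

noncomputable section

namespace ObstacleDG

/-! ### Gauss–Legendre quadrature on the reference interval -/

/-- The integral of a polynomial over the reference interval `(0,1)`, as a linear functional. -/
def unitInt : ℝ[X] →ₗ[ℝ] ℝ where
  toFun p := ∫ x in (0 : ℝ)..1, p.eval x
  map_add' p q := by
    simp only [eval_add]
    exact intervalIntegral.integral_add (p.continuous.intervalIntegrable _ _)
      (q.continuous.intervalIntegrable _ _)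
  map_smul' a p := by simp [eval_smul]

lemma unitInt_apply (p : ℝ[X]) : unitInt p = ∫ x in (0 : ℝ)..1, p.eval x := rfl

lemma unitInt_derivative (p : ℝ[X]) : unitInt (derivative p) = p.eval 1 - p.eval 0 := by
  rw [unitInt_apply]
  exact intervalIntegral.integral_eq_sub_of_hasDerivAt (fun x _ => p.hasDerivAt x)
    ((derivative p).continuous.intervalIntegrable _ _)

lemma unitInt_one : unitInt 1 = 1 := by simp [unitInt_apply]

lemma unitInt_nonneg {p : ℝ[X]} (hp : ∀ x ∈ Set.Ioo (0 : ℝ) 1, 0 ≤ p.eval x) :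
    0 ≤ unitInt p := by
  rw [unitInt_apply, intervalIntegral.integral_of_le zero_le_one,
    MeasureTheory.integral_Ioc_eq_integral_Ioo]
  exact MeasureTheory.setIntegral_nonneg measurableSet_Ioo hp

lemma unitInt_pos {p : ℝ[X]} (hp : ∀ x ∈ Set.Ioo (0 : ℝ) 1, 0 ≤ p.eval x) (h0 : p ≠ 0) :
    0 < unitInt p := by
  obtain ⟨x, hx, hxp⟩ : ∃ x ∈ Set.Ioo (0 : ℝ) 1, p.eval x ≠ 0 := by
    by_contra! hcon
    exact h0 (Polynomial.eq_zero_of_infinite_isRoot p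
      ((Set.Ioo_infinite (zero_lt_one (α := ℝ))).mono hcon))
  have hcl : ∀ x ∈ Set.Icc (0 : ℝ) 1, 0 ≤ p.eval x := by
    intro y hy
    rw [← closure_Ioo (zero_ne_one (α := ℝ))] at hy
    exact closure_minimal (t := {y | 0 ≤ p.eval y}) hp
      (isClosed_le continuous_const p.continuous) hy
  exact intervalIntegral.integral_pos zero_lt_one p.continuous.continuousOn
    (fun y hy => hcl y ⟨hy.1.le, hy.2⟩)
    ⟨x, ⟨hx.1.le, hx.2.le⟩, lt_of_le_of_ne (hp x hx) hxp.symm⟩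

lemma unitInt_mul_self_nonneg (p : ℝ[X]) : 0 ≤ unitInt (p * p) :=
  unitInt_nonneg fun x _ => by rw [eval_mul]; exact mul_self_nonneg _

lemma unitInt_mul_self_eq_zero {p : ℝ[X]} (h : unitInt (p * p) = 0) : p = 0 := by
  by_contra h0
  refine (unitInt_pos (p := p * p) (fun x _ => ?_) (mul_ne_zero h0 h0)).ne' h
  rw [eval_mul]; exact mul_self_nonneg _

/-- Repeated integration by parts: the derivatives of `X ^ n * (1 - X) ^ n` of order `m ≤ n` are
orthogonal to the polynomials of degree less than `m`. -/
lemma unitInt_iterate_derivative_mul (n m : ℕ) (hm : m ≤ n) (q : ℝ[X])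
    (hq : derivative^[m] q = 0) :
    unitInt (derivative^[m] (X ^ n * (1 - X) ^ n) * q) = 0 := by
  induction m generalizing q with
  | zero => simp only [Function.iterate_zero, id_eq] at hq; simp [hq]
  | succ m ih =>
    set W : ℝ[X] := derivative^[m] (X ^ n * (1 - X) ^ n) with hW
    have h0 : W.eval 0 = 0 := by
      have : X ^ (n - m) ∣ W :=
        pow_sub_dvd_iterate_derivative_of_pow_dvd m (Dvd.intro _ rfl)
      obtain ⟨r, hr⟩ := this
      rw [hr, eval_mul, eval_pow, eval_X, zero_pow (by omega), zero_mul]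
    have h1 : W.eval 1 = 0 := by
      have : (1 - X) ^ (n - m) ∣ W :=
        pow_sub_dvd_iterate_derivative_of_pow_dvd m (Dvd.intro_left _ rfl)
      obtain ⟨r, hr⟩ := this
      rw [hr, eval_mul, eval_pow, eval_sub, eval_X, eval_one, sub_self, zero_pow (by omega),
        zero_mul]
    have hparts := unitInt_derivative (W * q)
    rw [derivative_mul, map_add, eval_mul, eval_mul, h0, h1] at hparts
    rw [Function.iterate_succ_apply', ← hW]
    have := ih (by omega) (derivative q) (by rwa [Function.iterate_succ_apply] at hq)
    linarith

/-- The Legendre polynomial of degree `k + 1`, shifted to `(0,1)`, with real coefficients. -/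
def legendreReal (k : ℕ) : ℝ[X] := (shiftedLegendre (k + 1)).map (Int.castRingHom ℝ)

lemma natDegree_legendreReal (k : ℕ) : (legendreReal k).natDegree = k + 1 := by
  rw [legendreReal, natDegree_map_eq_of_injective (RingHom.injective_int _),
    natDegree_shiftedLegendre]

lemma legendreReal_ne_zero (k : ℕ) : legendreReal k ≠ 0 := by
  intro h
  have := natDegree_legendreReal k
  simp [h] at this

lemma rodrigues_real (k : ℕ) : C ((k + 1).factorial : ℝ) * legendreReal k =
    derivative^[k + 1] (X ^ (k + 1) * (1 - X) ^ (k + 1)) := by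
  have := congrArg (Polynomial.map (Int.castRingHom ℝ)) (factorial_mul_shiftedLegendre_eq (k + 1))
  rw [← iterate_derivative_map] at this
  simpa [legendreReal] using this

lemma unitInt_legendreReal_mul (k : ℕ) (q : ℝ[X]) (hq : q.natDegree ≤ k) :
    unitInt (legendreReal k * q) = 0 := by
  have h := unitInt_iterate_derivative_mul (k + 1) (k + 1) le_rfl q
    (iterate_derivative_eq_zero (by omega))
  rw [← rodrigues_real, mul_assoc, ← smul_eq_C_mul, map_smul, smul_eq_mul] at h
  exact (mul_eq_zero.1 h).resolve_left (by positivity)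

/-- By Rolle's theorem the Legendre polynomial has all its roots on the real line. -/
lemma card_roots_legendreReal (k : ℕ) : Multiset.card (legendreReal k).roots = k + 1 := by
  refine le_antisymm ((card_roots' _).trans_eq (natDegree_legendreReal k)) ?_
  have hW : (X ^ (k + 1) * (1 - X) ^ (k + 1) : ℝ[X]) ≠ 0 := by
    refine mul_ne_zero (pow_ne_zero _ X_ne_zero) (pow_ne_zero _ ?_)
    intro h
    have := congrArg (eval 0) h
    simp at this
  have h0 : Multiset.card (X ^ (k + 1) * (1 - X) ^ (k + 1) : ℝ[X]).roots = 2 * (k + 1) := by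
    have h1 : (1 - X : ℝ[X]) = -(X - C 1) := by simp
    rw [roots_mul hW, h1, roots_pow, roots_pow, roots_neg, roots_X_sub_C, roots_X]
    simp; ring
  have hit : ∀ (m : ℕ) (p : ℝ[X]),
      Multiset.card p.roots ≤ Multiset.card (derivative^[m] p).roots + m := by
    intro m
    induction m with
    | zero => intro p; simp
    | succ m ih =>
      intro p
      have := card_roots_le_derivative (derivative^[m] p)
      rw [Function.iterate_succ_apply']
      have := ih p
      omega
  have := hit (k + 1) (X ^ (k + 1) * (1 - X) ^ (k + 1))
  rw [← rodrigues_real, roots_C_mul _ (by positivity)] at this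
  omega

/-- A root outside `(0,1)` would make the quotient by it sign-definite against the Legendre
polynomial, contradicting orthogonality. -/
lemma mem_Ioo_of_isRoot_legendreReal {k : ℕ} {r : ℝ} (hr : (legendreReal k).IsRoot r) :
    r ∈ Set.Ioo (0 : ℝ) 1 := by
  obtain ⟨s, hs⟩ := dvd_iff_isRoot.2 hr
  have hs0 : s ≠ 0 := by
    rintro rfl
    exact legendreReal_ne_zero k (by simpa using hs)
  have hdeg : s.natDegree ≤ k := by
    have h := natDegree_legendreReal k
    rw [hs, natDegree_mul (X_sub_C_ne_zero r) hs0, natDegree_X_sub_C] at h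
    omega
  have horth := unitInt_legendreReal_mul k s hdeg
  have hne : (X - C r) * s * s ≠ 0 := mul_ne_zero (mul_ne_zero (X_sub_C_ne_zero r) hs0) hs0
  rw [hs] at horth
  by_contra hcon
  rw [Set.mem_Ioo, not_and_or, not_lt, not_lt] at hcon
  rcases hcon with h | h
  · refine (unitInt_pos (fun x hx => ?_) hne).ne' horth
    rw [eval_mul, eval_mul, mul_assoc, eval_sub, eval_X, eval_C]
    exact mul_nonneg (by linarith [hx.1]) (mul_self_nonneg _)
  · refine (unitInt_pos (p := -((X - C r) * s * s)) (fun x hx => ?_) (neg_ne_zero.2 hne)).ne' ?_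
    · rw [eval_neg, eval_mul, eval_mul, mul_assoc, eval_sub, eval_X, eval_C, ← neg_mul]
      exact mul_nonneg (by linarith [hx.2]) (mul_self_nonneg _)
    · rw [map_neg, horth, neg_zero]

lemma nodup_roots_legendreReal (k : ℕ) : (legendreReal k).roots.Nodup := by
  rw [Multiset.nodup_iff_count_le_one]
  intro r
  by_contra! hcon
  rw [count_roots] at hcon
  have hdvd : (X - C r) ^ 2 ∣ legendreReal k :=
    (le_rootMultiplicity_iff (legendreReal_ne_zero k)).1 hcon
  obtain ⟨s, hs⟩ := hdvd
  have hs0 : s ≠ 0 := by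
    rintro rfl
    exact legendreReal_ne_zero k (by simpa using hs)
  have hdeg : s.natDegree ≤ k := by
    have h := natDegree_legendreReal k
    rw [hs, natDegree_mul (pow_ne_zero _ (X_sub_C_ne_zero r)) hs0, natDegree_pow,
      natDegree_X_sub_C] at h
    omega
  have horth := unitInt_legendreReal_mul k s hdeg
  rw [hs] at horth
  refine (unitInt_pos (fun x _ => ?_)
    (mul_ne_zero (mul_ne_zero (pow_ne_zero _ (X_sub_C_ne_zero r)) hs0) hs0)).ne' horth
  rw [eval_mul, eval_mul, mul_assoc, eval_pow]
  exact mul_nonneg (sq_nonneg _) (mul_self_nonneg _)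

/-- The Gauss–Legendre points of `(0,1)` as a finite set. -/
def gaussNodes (k : ℕ) : Finset ℝ := (legendreReal k).roots.toFinset

lemma mem_gaussNodes {k : ℕ} {r : ℝ} : r ∈ gaussNodes k ↔ (legendreReal k).IsRoot r := by
  rw [gaussNodes, Multiset.mem_toFinset, mem_roots (legendreReal_ne_zero k)]

lemma mem_gaussPoints_iff {k : ℕ} {r : ℝ} : r ∈ gaussPoints k ↔ r ∈ gaussNodes k := by
  rw [mem_gaussNodes, gaussPoints, Set.mem_ofPred_eq, IsRoot.def, legendreReal, eval_map,
    aeval_def]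
  rfl

lemma card_gaussNodes (k : ℕ) : (gaussNodes k).card = k + 1 := by
  rw [gaussNodes, Multiset.toFinset_card_of_nodup (nodup_roots_legendreReal k),
    card_roots_legendreReal]

lemma gaussNodes_mem_Ioo {k : ℕ} {r : ℝ} (hr : r ∈ gaussNodes k) : r ∈ Set.Ioo (0 : ℝ) 1 :=
  mem_Ioo_of_isRoot_legendreReal (mem_gaussNodes.1 hr)

/-- The weights of Gauss–Legendre quadrature. -/
def gaussWeight (k : ℕ) (r : ℝ) : ℝ := unitInt (Lagrange.basis (gaussNodes k) id r)

/-- Interpolation at the Gauss–Legendre points by a polynomial of degree at most `k`. -/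
def gaussInterp (k : ℕ) (f : ℝ → ℝ) : ℝ[X] := Lagrange.interpolate (gaussNodes k) id f

lemma natDegree_lt_card_iff {k : ℕ} {p : ℝ[X]} :
    p.degree < (gaussNodes k).card ↔ p.natDegree ≤ k := by
  rw [card_gaussNodes]
  constructor
  · intro h
    rcases eq_or_ne p 0 with rfl | hp
    · simp
    · have := (natDegree_lt_iff_degree_lt hp).2 h
      omega
  · intro h
    exact lt_of_le_of_lt (degree_le_natDegree) (by exact_mod_cast Nat.lt_succ_of_le h)

lemma natDegree_gaussInterp (k : ℕ) (f : ℝ → ℝ) : (gaussInterp k f).natDegree ≤ k :=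
  natDegree_lt_card_iff.1 (Lagrange.degree_interpolate_lt _ Function.injective_id.injOn)

lemma eval_gaussInterp {k : ℕ} (f : ℝ → ℝ) {r : ℝ} (hr : r ∈ gaussNodes k) :
    (gaussInterp k f).eval r = f r :=
  Lagrange.eval_interpolate_at_node f Function.injective_id.injOn hr

lemma eq_gaussInterp {k : ℕ} {p : ℝ[X]} (hp : p.natDegree ≤ k) {f : ℝ → ℝ}
    (h : ∀ r ∈ gaussNodes k, p.eval r = f r) : p = gaussInterp k f :=
  Lagrange.eq_interpolate_of_eval_eq f Function.injective_id.injOn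
    (natDegree_lt_card_iff.2 hp) h

lemma unitInt_eq_sum_of_natDegree_le {k : ℕ} {p : ℝ[X]} (hp : p.natDegree ≤ k) :
    unitInt p = ∑ r ∈ gaussNodes k, gaussWeight k r * p.eval r := by
  have h := eq_gaussInterp hp (f := fun r => p.eval r) (fun _ _ => rfl)
  conv_lhs => rw [h, gaussInterp, Lagrange.interpolate_apply, map_sum]
  refine Finset.sum_congr rfl fun r _ => ?_
  rw [← smul_eq_C_mul, map_smul, smul_eq_mul, mul_comm, gaussWeight]

/-- Gauss–Legendre quadrature with `k + 1` points is exact up to degree `2 k + 1`. -/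
theorem unitInt_eq_gauss_sum {k : ℕ} {p : ℝ[X]} (hp : p.natDegree ≤ 2 * k + 1) :
    unitInt p = ∑ r ∈ gaussNodes k, gaussWeight k r * p.eval r := by
  have hL := legendreReal_ne_zero k
  have hdecomp := EuclideanDomain.div_add_mod p (legendreReal k)
  have hmod : (p % legendreReal k).natDegree ≤ k := by
    have := natDegree_mod_lt p (q := legendreReal k) (by rw [natDegree_legendreReal]; omega)
    rw [natDegree_legendreReal] at this
    omega
  have hdiv : (p / legendreReal k).natDegree ≤ k := by
    rcases eq_or_ne (p / legendreReal k) 0 with h0 | h0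
    · simp [h0]
    have h1 : (legendreReal k * (p / legendreReal k)).natDegree ≤ 2 * k + 1 := by
      rw [eq_sub_of_add_eq hdecomp]
      exact (natDegree_sub_le _ _).trans (max_le hp (by omega))
    rw [natDegree_mul hL h0, natDegree_legendreReal] at h1
    omega
  conv_lhs => rw [← hdecomp, map_add, unitInt_legendreReal_mul k _ hdiv, zero_add,
    unitInt_eq_sum_of_natDegree_le hmod]
  refine Finset.sum_congr rfl fun r hr => ?_
  conv_rhs => rw [← hdecomp]
  rw [eval_add, eval_mul, (mem_gaussNodes.1 hr).eq_zero, zero_mul, zero_add]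

lemma gaussWeight_pos {k : ℕ} {r : ℝ} (hr : r ∈ gaussNodes k) : 0 < gaussWeight k r := by
  set b := Lagrange.basis (gaussNodes k) id r with hb
  have hb0 : b ≠ 0 := Lagrange.basis_ne_zero Function.injective_id.injOn hr
  have hdeg : b.natDegree = k := by
    rw [hb, Lagrange.natDegree_basis Function.injective_id.injOn hr, card_gaussNodes,
      Nat.add_sub_cancel]
  have h := unitInt_eq_gauss_sum (k := k) (p := b * b)
    (by rw [natDegree_mul hb0 hb0, hdeg]; omega)
  rw [Finset.sum_eq_single r] at h
  · have h1 : b.eval r = 1 :=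
      Lagrange.eval_basis_self (v := id) Function.injective_id.injOn hr
    rw [eval_mul, h1, mul_one, mul_one] at h
    rw [← h]
    exact unitInt_pos (fun x _ => by rw [eval_mul]; exact mul_self_nonneg _) (mul_ne_zero hb0 hb0)
  · intro s hs hsr
    have h0 : b.eval s = 0 := Lagrange.eval_basis_of_ne (v := id) hsr.symm hs
    rw [eval_mul, h0]; simp
  · exact fun h => absurd hr h

lemma sum_gaussWeight (k : ℕ) : ∑ r ∈ gaussNodes k, gaussWeight k r = 1 := by
  have h := unitInt_eq_gauss_sum (k := k) (p := 1) (by simp)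
  rw [unitInt_one] at h
  simpa using h.symm

/-! ### Norms of polynomials on the reference interval -/

/-- The values of a polynomial at the Gauss–Legendre points, weighted so that the Euclidean norm
of the vector is the `L²(0,1)` norm for polynomials of degree at most `k`. -/
def gaussVec (k : ℕ) : ℝ[X] →ₗ[ℝ] EuclideanSpace ℝ (gaussNodes k) where
  toFun p := WithLp.toLp 2 fun r => √(gaussWeight k r) * p.eval (r : ℝ)
  map_add' p q := by ext r; simp [mul_add]
  map_smul' a p := by ext r; simp [mul_left_comm]

lemma gaussVec_apply (k : ℕ) (p : ℝ[X]) (r : gaussNodes k) :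
    gaussVec k p r = √(gaussWeight k r) * p.eval (r : ℝ) := rfl

lemma norm_gaussVec_sq (k : ℕ) (p : ℝ[X]) :
    ‖gaussVec k p‖ ^ 2 = ∑ r ∈ gaussNodes k, gaussWeight k r * p.eval r ^ 2 := by
  rw [EuclideanSpace.norm_sq_eq, ← Finset.sum_coe_sort (gaussNodes k)]
  refine Finset.sum_congr rfl fun r _ => ?_
  rw [gaussVec_apply, Real.norm_eq_abs, sq_abs, mul_pow, Real.sq_sqrt (gaussWeight_pos r.2).le]

lemma unitInt_mul_eq_sum {k : ℕ} {p q : ℝ[X]} (hp : p.natDegree ≤ k) (hq : q.natDegree ≤ k) :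
    unitInt (p * q) = ∑ r ∈ gaussNodes k, gaussWeight k r * (p.eval r * q.eval r) := by
  rw [unitInt_eq_gauss_sum (k := k) (natDegree_mul_le.trans (by omega))]
  simp only [eval_mul]

lemma norm_gaussVec_sq_eq_unitInt {k : ℕ} {p : ℝ[X]} (hp : p.natDegree ≤ k) :
    ‖gaussVec k p‖ ^ 2 = unitInt (p * p) := by
  rw [norm_gaussVec_sq, unitInt_mul_eq_sum hp hp]
  simp only [sq]

lemma norm_gaussVec_le {k : ℕ} {p : ℝ[X]} {ε : ℝ} (hε : 0 ≤ ε)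
    (h : ∀ r ∈ gaussNodes k, |p.eval r| ≤ ε) : ‖gaussVec k p‖ ≤ ε := by
  refine abs_le_of_sq_le_sq' ?_ hε |>.2
  rw [norm_gaussVec_sq, ← one_mul (ε ^ 2), ← sum_gaussWeight k, Finset.sum_mul]
  refine Finset.sum_le_sum fun r hr => ?_
  exact mul_le_mul_of_nonneg_left (sq_le_sq' (abs_le.1 (h r hr)).1 (abs_le.1 (h r hr)).2)
    (gaussWeight_pos hr).le

/-- On polynomials of degree at most `k` every linear map into a normed space is bounded with
respect to the `L²(0,1)` norm. -/
lemma exists_norm_le_mul_norm_gaussVec (k : ℕ) {E : Type*} [SeminormedAddCommGroup E]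
    [NormedSpace ℝ E] (T : ℝ[X] →ₗ[ℝ] E) :
    ∃ K : ℝ, 0 ≤ K ∧ ∀ p : ℝ[X], p.natDegree ≤ k → ‖T p‖ ≤ K * ‖gaussVec k p‖ := by
  refine ⟨∑ r : gaussNodes k, ‖T (Lagrange.basis (gaussNodes k) id (r : ℝ))‖ /
    √(gaussWeight k r), Finset.sum_nonneg fun r _ => by positivity, fun p hp => ?_⟩
  have h := eq_gaussInterp hp (f := fun r => p.eval r) (fun _ _ => rfl)
  rw [gaussInterp, Lagrange.interpolate_apply, ← Finset.sum_coe_sort] at h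
  conv_lhs => rw [h, map_sum]
  refine (norm_sum_le _ _).trans ?_
  rw [Finset.sum_mul]
  refine Finset.sum_le_sum fun r _ => ?_
  have hw : 0 < √(gaussWeight k r) := Real.sqrt_pos.2 (gaussWeight_pos r.2)
  have hr : √(gaussWeight k r) * |p.eval (r : ℝ)| ≤ ‖gaussVec k p‖ := by
    have := PiLp.norm_apply_le (gaussVec k p) r
    rwa [gaussVec_apply, Real.norm_eq_abs, abs_mul, abs_of_pos hw] at this
  rw [← smul_eq_C_mul, map_smul, norm_smul, Real.norm_eq_abs, div_mul_eq_mul_div,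
    le_div_iff₀ hw]
  nlinarith [norm_nonneg (T (Lagrange.basis (gaussNodes k) id (r : ℝ)))]

/-- The maximum over the reference interval of every polynomial of degree at most `k` is at most
`K` times its `L²` norm. -/
def EvalBound (k : ℕ) (K : ℝ) : Prop :=
  0 ≤ K ∧ ∀ p : ℝ[X], p.natDegree ≤ k →
    ∀ x ∈ Set.Icc (0 : ℝ) 1, |p.eval x| ≤ K * ‖gaussVec k p‖

lemma exists_evalBound (k : ℕ) : ∃ K : ℝ, EvalBound k K := by
  let T : ℝ[X] →ₗ[ℝ] (Fin (k + 1) → ℝ) := LinearMap.pi fun i => lcoeff ℝ i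
  obtain ⟨K, hK, hT⟩ := exists_norm_le_mul_norm_gaussVec k T
  refine ⟨(k + 1) * K, by positivity, fun p hp x hx => ?_⟩
  rw [eval_eq_sum_range' (Nat.lt_succ_of_le hp), mul_assoc]
  refine (Finset.abs_sum_le_sum_abs _ _).trans ?_
  have hterm : ∀ i ∈ Finset.range (k + 1), |p.coeff i * x ^ i| ≤ K * ‖gaussVec k p‖ := by
    intro i hi
    have h1 : ‖T p ⟨i, Finset.mem_range.1 hi⟩‖ ≤ ‖T p‖ := norm_le_pi_norm (T p) _
    have h2 : T p ⟨i, Finset.mem_range.1 hi⟩ = p.coeff i := rfl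
    rw [h2, Real.norm_eq_abs] at h1
    rw [abs_mul, abs_of_nonneg (pow_nonneg hx.1 i)]
    exact (mul_le_of_le_one_right (abs_nonneg _) (pow_le_one₀ hx.1 hx.2)).trans
      (h1.trans (hT p hp))
  refine (Finset.sum_le_sum hterm).trans ?_
  simp

/-- The Riesz representer in the polynomials of degree at most `k` of evaluation at the left
endpoint of the reference interval. -/
def leftDelta (k : ℕ) : ℝ[X] :=
  gaussInterp k fun r => (Lagrange.basis (gaussNodes k) id r).eval 0 / gaussWeight k r

lemma natDegree_leftDelta (k : ℕ) : (leftDelta k).natDegree ≤ k := natDegree_gaussInterp k _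

lemma unitInt_leftDelta_mul {k : ℕ} {p : ℝ[X]} (hp : p.natDegree ≤ k) :
    unitInt (leftDelta k * p) = p.eval 0 := by
  rw [unitInt_mul_eq_sum (natDegree_leftDelta k) hp]
  have h := eq_gaussInterp hp (f := fun r => p.eval r) (fun _ _ => rfl)
  rw [gaussInterp, Lagrange.interpolate_apply] at h
  conv_rhs => rw [h, eval_finsetSum]
  refine Finset.sum_congr rfl fun r hr => ?_
  rw [leftDelta, eval_gaussInterp _ hr, eval_mul, eval_C]
  field_simp [(gaussWeight_pos hr).ne']

/-! ### Strong stability of the third order Runge–Kutta method -/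

/-- One step of the third order Runge–Kutta method for the linear equation `v' = A v`, with the
time step absorbed in `A`. -/
def rkMap {V : Type*} [AddCommGroup V] [Module ℝ V] (A : V →ₗ[ℝ] V) : V →ₗ[ℝ] V :=
  LinearMap.id + A + (1 / 2 : ℝ) • (A ∘ₗ A) + (1 / 6 : ℝ) • (A ∘ₗ A ∘ₗ A)

lemma rkMap_apply {V : Type*} [AddCommGroup V] [Module ℝ V] (A : V →ₗ[ℝ] V) (v : V) :
    rkMap A v = v + A v + (1 / 2 : ℝ) • A (A v) + (1 / 6 : ℝ) • A (A (A v)) := rfl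

/-- The third order Runge–Kutta method is a contraction for every dissipative operator of norm at
most one. With `[x, y] = -⟪A x, y⟫ - ⟪x, A y⟫`, the energy identity reads
`‖P v‖² - ‖v‖² = -[d, d] - [e, e] / 12 + [A²v, A²v] / 36 - ‖A²v‖² / 12 + ‖A³v‖² / 36`
where `d = v + A v / 2 + A²v / 6` and `e = A v + A²v`. -/
theorem norm_rkMap_le {V E : Type*} [AddCommGroup V] [Module ℝ V] [NormedAddCommGroup E]
    [InnerProductSpace ℝ E] (A : V →ₗ[ℝ] V) (ι : V →ₗ[ℝ] E) (W : Submodule ℝ V)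
    (hAW : ∀ v ∈ W, A v ∈ W) (hdiss : ∀ v ∈ W, inner ℝ (ι (A v)) (ι v) ≤ 0)
    (hbd : ∀ v ∈ W, ‖ι (A v)‖ ≤ ‖ι v‖) {v : V} (hv : v ∈ W) : ‖ι (rkMap A v)‖ ≤ ‖ι v‖ := by
  have h1 := hAW _ hv
  have h2 := hAW _ h1
  have hd := hdiss (v + (1 / 2 : ℝ) • A v + (1 / 6 : ℝ) • A (A v))
    (W.add_mem (W.add_mem hv (W.smul_mem _ h1)) (W.smul_mem _ h2))
  have he := hdiss (A v + A (A v)) (W.add_mem h1 h2)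
  have hb := hbd _ h2
  refine abs_le_of_sq_le_sq' ?_ (norm_nonneg _) |>.2
  rw [rkMap_apply]
  simp only [map_add, map_smul] at hd he ⊢
  generalize ι v = x0 at *
  generalize ι (A v) = x1 at *
  generalize ι (A (A v)) = x2 at *
  generalize ι (A (A (A v))) = x3 at *
  have hcs : -(inner ℝ x3 x2) ≤ ‖x2‖ ^ 2 := by
    have := (abs_le.1 (abs_real_inner_le_norm x3 x2)).1
    nlinarith [norm_nonneg x2]
  have hb2 : ‖x3‖ ^ 2 ≤ ‖x2‖ ^ 2 := by gcongr
  rw [← real_inner_self_eq_norm_sq] at hcs hb2 ⊢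
  rw [← real_inner_self_eq_norm_sq] at hb2 ⊢
  simp only [inner_add_left, inner_add_right, real_inner_smul_left, real_inner_smul_right]
    at hd he ⊢
  rw [real_inner_comm x0 x1, real_inner_comm x0 x2, real_inner_comm x0 x3, real_inner_comm x1 x2,
    real_inner_comm x1 x3, real_inner_comm x2 x3] at *
  linarith

/-! ### The discontinuous Galerkin operator in reference coordinates -/

section
variable {N : ℕ}

lemma Mesh.left_lt_right (M : Mesh N) (j : Fin N) : M.left j < M.right j :=
  M.strictMono (Fin.castSucc_lt_succ)

lemma Mesh.width_pos (M : Mesh N) (j : Fin N) : 0 < M.width j := sub_pos.2 (M.left_lt_right j)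

lemma Mesh.point_zero (M : Mesh N) (j : Fin N) : M.point j 0 = M.left j := by simp [Mesh.point]

lemma Mesh.point_one (M : Mesh N) (j : Fin N) : M.point j 1 = M.right j := by
  simp [Mesh.point, Mesh.width]

lemma Mesh.integral_eq (M : Mesh N) (j : Fin N) (f : ℝ → ℝ) :
    ∫ x in (M.left j)..(M.right j), f x = M.width j * ∫ r in (0 : ℝ)..1, f (M.point j r) := by
  have := intervalIntegral.smul_integral_comp_add_mul (a := 0) (b := 1) f (M.width j) (M.left j)
  rw [mul_zero, add_zero, mul_one, smul_eq_mul] at this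
  rw [show M.right j = M.left j + M.width j by simp [Mesh.width], ← this]
  rfl

/-- A piecewise polynomial in the reference coordinate of each cell. -/
def toRef (M : Mesh N) : (Fin N → ℝ[X]) →ₗ[ℝ] (Fin N → ℝ[X]) where
  toFun v j := (v j).comp (C (M.left j) + C (M.width j) * X)
  map_add' v w := by ext1 j; simp
  map_smul' a v := by ext1 j; simp

lemma toRef_apply (M : Mesh N) (v : Fin N → ℝ[X]) (j : Fin N) :
    toRef M v j = (v j).comp (C (M.left j) + C (M.width j) * X) := rfl

lemma eval_toRef (M : Mesh N) (v : Fin N → ℝ[X]) (j : Fin N) (r : ℝ) :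
    (toRef M v j).eval r = (v j).eval (M.point j r) := by
  simp [toRef_apply, Mesh.point]

/-- The piecewise polynomial with given reference coordinates. -/
def ofRef (M : Mesh N) (Q : Fin N → ℝ[X]) (j : Fin N) : ℝ[X] :=
  (Q j).comp (C (M.width j)⁻¹ * (X - C (M.left j)))

lemma toRef_ofRef (M : Mesh N) (Q : Fin N → ℝ[X]) : toRef M (ofRef M Q) = Q := by
  ext1 j
  have h : C (M.width j)⁻¹ * C (M.width j) = (1 : ℝ[X]) := by
    rw [← C_mul, inv_mul_cancel₀ (M.width_pos j).ne', C_1]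
  rw [toRef_apply, ofRef, comp_assoc, mul_comp, C_comp, sub_comp, X_comp, C_comp,
    add_sub_cancel_left, ← mul_assoc, h, one_mul, comp_X]

/-- `V_h` as a subspace. -/
def dgSubmodule (N k : ℕ) : Submodule ℝ (Fin N → ℝ[X]) where
  carrier := DGSpace N k
  add_mem' hv hw j := (natDegree_add_le _ _).trans (max_le (hv j) (hw j))
  zero_mem' j := by simp
  smul_mem' a v hv j := (natDegree_smul_le a _).trans (hv j)

lemma toRef_mem {k : ℕ} (M : Mesh N) {v : Fin N → ℝ[X]} (hv : v ∈ DGSpace N k) :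
    toRef M v ∈ DGSpace N k := fun j => by
  have h1 : (C (M.left j) + C (M.width j) * X : ℝ[X]).natDegree ≤ 1 := by compute_degree
  calc (toRef M v j).natDegree ≤ (v j).natDegree * _ := natDegree_comp_le
    _ ≤ k * 1 := Nat.mul_le_mul (hv j) h1
    _ = k := mul_one k

lemma ofRef_mem {k : ℕ} (M : Mesh N) {Q : Fin N → ℝ[X]} (hQ : Q ∈ DGSpace N k) :
    ofRef M Q ∈ DGSpace N k := fun j => by
  have h1 : (C (M.width j)⁻¹ * (X - C (M.left j)) : ℝ[X]).natDegree ≤ 1 := by compute_degree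
  calc (ofRef M Q j).natDegree ≤ (Q j).natDegree * _ := natDegree_comp_le
    _ ≤ k * 1 := Nat.mul_le_mul (hQ j) h1
    _ = k := mul_one k

lemma l2Inner_eq (M : Mesh N) (v φ : Fin N → ℝ[X]) :
    l2Inner M v φ = ∑ j, M.width j * unitInt (toRef M v j * toRef M φ j) := by
  refine Finset.sum_congr rfl fun j _ => ?_
  rw [M.integral_eq, unitInt_apply]
  simp only [eval_mul, eval_toRef]

lemma derivative_toRef (M : Mesh N) (φ : Fin N → ℝ[X]) (j : Fin N) (r : ℝ) :
    (derivative (toRef M φ j)).eval r = M.width j * (derivative (φ j)).eval (M.point j r) := by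
  simp [toRef_apply, derivative_comp, Mesh.point]

/-- The values at all Gauss–Legendre points of all cells, weighted so that the Euclidean norm is
the `L²(0,1)` norm on `V_h`. -/
def meshVec (M : Mesh N) (k : ℕ) :
    (Fin N → ℝ[X]) →ₗ[ℝ] EuclideanSpace ℝ (Fin N × gaussNodes k) where
  toFun Q := WithLp.toLp 2 fun i => √(M.width i.1) * gaussVec k (Q i.1) i.2
  map_add' P Q := by ext i; simp [mul_add]
  map_smul' a Q := by ext i; simp [mul_left_comm]

lemma meshVec_apply (M : Mesh N) (k : ℕ) (Q : Fin N → ℝ[X]) (i : Fin N × gaussNodes k) :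
    meshVec M k Q i = √(M.width i.1) * gaussVec k (Q i.1) i.2 := rfl

lemma norm_meshVec_sq (M : Mesh N) (k : ℕ) (Q : Fin N → ℝ[X]) :
    ‖meshVec M k Q‖ ^ 2 = ∑ j, M.width j * ‖gaussVec k (Q j)‖ ^ 2 := by
  rw [EuclideanSpace.norm_sq_eq, Fintype.sum_prod_type]
  refine Finset.sum_congr rfl fun j _ => ?_
  rw [EuclideanSpace.norm_sq_eq, Finset.mul_sum]
  refine Finset.sum_congr rfl fun r _ => ?_
  rw [meshVec_apply, norm_mul, mul_pow, Real.norm_eq_abs, sq_abs,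
    Real.sq_sqrt (M.width_pos j).le]

lemma inner_meshVec (M : Mesh N) {k : ℕ} {P Q : Fin N → ℝ[X]} (hP : P ∈ DGSpace N k)
    (hQ : Q ∈ DGSpace N k) :
    inner ℝ (meshVec M k P) (meshVec M k Q) = ∑ j, M.width j * unitInt (P j * Q j) := by
  rw [PiLp.inner_apply, Fintype.sum_prod_type]
  refine Finset.sum_congr rfl fun j _ => ?_
  rw [unitInt_mul_eq_sum (hP j) (hQ j), ← Finset.sum_coe_sort (gaussNodes k), Finset.mul_sum]
  refine Finset.sum_congr rfl fun r _ => ?_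
  have h1 := Real.mul_self_sqrt (M.width_pos j).le
  have h2 := Real.mul_self_sqrt (gaussWeight_pos r.2).le
  simp only [meshVec_apply, gaussVec_apply, RCLike.inner_apply, conj_trivial]
  linear_combination (gaussWeight k r * (P j).eval (r : ℝ) * (Q j).eval (r : ℝ)) * h1 +
    (√(M.width j) * √(M.width j) * (P j).eval (r : ℝ) * (Q j).eval (r : ℝ)) * h2

variable [NeZero N]

lemma dgForm_eq (M : Mesh N) (c : ℝ) (v φ : Fin N → ℝ[X]) :
    dgForm M c v φ = c * ∑ j, (unitInt (toRef M v j * derivative (toRef M φ j))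
      - ((toRef M v j).eval 1 * (toRef M φ j).eval 1
        - (toRef M v (j - 1)).eval 1 * (toRef M φ j).eval 0)) := by
  rw [dgForm, Finset.mul_sum]
  refine Finset.sum_congr rfl fun j _ => ?_
  have hint : ∫ x in (M.left j)..(M.right j), c * (v j).eval x * (derivative (φ j)).eval x =
      c * unitInt (toRef M v j * derivative (toRef M φ j)) := by
    rw [M.integral_eq, unitInt_apply, ← intervalIntegral.integral_const_mul,
      ← intervalIntegral.integral_const_mul]
    refine intervalIntegral.integral_congr fun r _ => ?_
    simp only [eval_mul, derivative_toRef, eval_toRef]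
    ring
  simp only [hint, eval_toRef, M.point_one, M.point_zero]
  ring

/-- The semidiscrete upwind operator in reference coordinates. In strong form it is
`-q' + (q⁻ - q⁺) δ` on each cell, with `δ` the representer of evaluation at the left endpoint,
and with the factor `a j`, which stands for `c Δt / h_j`. -/
def dgOp (k : ℕ) (a : Fin N → ℝ) : (Fin N → ℝ[X]) →ₗ[ℝ] (Fin N → ℝ[X]) where
  toFun Q j := a j • (-derivative (Q j) + ((Q (j - 1)).eval 1 - (Q j).eval 0) • leftDelta k)
  map_add' P Q := by
    ext1 j
    simp only [Pi.add_apply, derivative_add, eval_add]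
    module
  map_smul' b Q := by
    ext1 j
    simp only [Pi.smul_apply, derivative_smul, eval_smul, smul_eq_mul, RingHom.id_apply]
    module

lemma dgOp_apply (k : ℕ) (a : Fin N → ℝ) (Q : Fin N → ℝ[X]) (j : Fin N) : dgOp k a Q j =
    a j • (-derivative (Q j) + ((Q (j - 1)).eval 1 - (Q j).eval 0) • leftDelta k) := rfl

lemma dgOp_mem {k : ℕ} (a : Fin N → ℝ) {Q : Fin N → ℝ[X]} (hQ : Q ∈ DGSpace N k) :
    dgOp k a Q ∈ DGSpace N k := fun j => by
  rw [dgOp_apply]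
  refine (natDegree_smul_le _ _).trans ((natDegree_add_le _ _).trans (max_le ?_ ?_))
  · rw [natDegree_neg]
    exact (natDegree_derivative_le _).trans ((Nat.sub_le _ _).trans (hQ j))
  · exact (natDegree_smul_le _ _).trans (natDegree_leftDelta k)

lemma unitInt_dgOp_mul {k : ℕ} (a : Fin N → ℝ) (Q : Fin N → ℝ[X]) (j : Fin N) {p : ℝ[X]}
    (hp : p.natDegree ≤ k) : unitInt (dgOp k a Q j * p) =
      a j * (unitInt (Q j * derivative p) -
        ((Q j).eval 1 * p.eval 1 - (Q (j - 1)).eval 1 * p.eval 0)) := by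
  have hparts := unitInt_derivative (Q j * p)
  rw [derivative_mul, map_add, eval_mul, eval_mul] at hparts
  rw [dgOp_apply, smul_mul_assoc, map_smul, smul_eq_mul, add_mul, map_add, neg_mul, map_neg,
    smul_mul_assoc, map_smul, smul_eq_mul, unitInt_leftDelta_mul hp]
  congr 1
  linarith

/-- The weak form of a stage of the scheme determines the stage by the operator `dgOp`. -/
lemma toRef_eq_dgOp {k : ℕ} (M : Mesh N) (c τ : ℝ) {d v : Fin N → ℝ[X]} (hd : d ∈ DGSpace N k)
    (hv : v ∈ DGSpace N k)
    (h : ∀ φ ∈ DGSpace N k, l2Inner M d φ = τ * dgForm M c v φ) :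
    toRef M d = dgOp k (fun j => c * τ / M.width j) (toRef M v) := by
  set a : Fin N → ℝ := fun j => c * τ / M.width j with ha
  set E := toRef M d - dgOp k a (toRef M v) with hE
  have hEmem : E ∈ DGSpace N k :=
    (dgSubmodule N k).sub_mem (toRef_mem M hd) (dgOp_mem a (toRef_mem M hv))
  have h1 := h (ofRef M E) (ofRef_mem M hEmem)
  rw [l2Inner_eq, dgForm_eq, toRef_ofRef, ← mul_assoc, Finset.mul_sum] at h1
  have h2 : ∑ j, M.width j * unitInt (E j * E j) = 0 := by
    rw [← sub_eq_zero.2 h1, ← Finset.sum_sub_distrib]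
    refine Finset.sum_congr rfl fun j _ => ?_
    have h3 := unitInt_dgOp_mul a (toRef M v) j (hEmem j)
    have h4 : unitInt (E j * E j) =
        unitInt (toRef M d j * E j) - unitInt (dgOp k a (toRef M v) j * E j) := by
      rw [← map_sub, ← sub_mul]; rfl
    rw [h4, h3, ha]
    have := (M.width_pos j).ne'
    field_simp
  have h5 : ∀ j, E j = 0 := by
    intro j
    rw [Finset.sum_eq_zero_iff_of_nonneg fun j _ =>
      mul_nonneg (M.width_pos j).le (unitInt_mul_self_nonneg _)] at h2
    exact unitInt_mul_self_eq_zero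
      ((mul_eq_zero.1 (h2 j (Finset.mem_univ j))).resolve_left (M.width_pos j).ne')
  exact sub_eq_zero.1 (funext h5)

/-- A step of the scheme is the Runge–Kutta map of the operator `dgOp`. -/
lemma IsRKStep.toRef_eq {k : ℕ} {M : Mesh N} {c Δt : ℝ} {v w : Fin N → ℝ[X]}
    (hv : v ∈ DGSpace N k) (h : IsRKStep M k c Δt v w) :
    toRef M w = rkMap (dgOp k fun j => c * Δt / M.width j) (toRef M v) := by
  obtain ⟨v₁, hv₁, v₂, hv₂, hw, h1, h2, h3⟩ := h
  have key : ∀ (θ : ℝ) {d z : Fin N → ℝ[X]}, d ∈ DGSpace N k → z ∈ DGSpace N k →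
      (∀ φ ∈ DGSpace N k, l2Inner M d φ = θ * Δt * dgForm M c z φ) →
      toRef M d = θ • dgOp k (fun j => c * Δt / M.width j) (toRef M z) := by
    intro θ d z hd hz hdz
    rw [toRef_eq_dgOp M c (θ * Δt) hd hz hdz]
    ext1 j
    rw [Pi.smul_apply, dgOp_apply, dgOp_apply, smul_smul]
    congr 1
    ring
  have mem := fun {a b : Fin N → ℝ[X]} (ha : a ∈ DGSpace N k) (hb : b ∈ DGSpace N k) =>
    (dgSubmodule N k).sub_mem ha hb
  have smem := fun (t : ℝ) {a : Fin N → ℝ[X]} (ha : a ∈ DGSpace N k) =>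
    (dgSubmodule N k).smul_mem t ha
  have e1 := key 1 (mem hv₁ hv) hv (fun φ hφ => by rw [h1 φ hφ]; ring)
  have e2 := key (1 / 4) (mem (mem hv₂ (smem _ hv)) (smem _ hv₁)) hv₁
    (fun φ hφ => by rw [h2 φ hφ]; ring)
  have e3 := key (2 / 3) (mem (mem hw (smem _ hv)) (smem _ hv₂)) hv₂
    (fun φ hφ => by rw [h3 φ hφ]; ring)
  simp only [map_sub, map_smul] at e1 e2 e3
  generalize dgOp k (fun j => c * Δt / M.width j) = A at *
  generalize toRef M v = V at *
  generalize toRef M v₁ = V₁ at *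
  generalize toRef M v₂ = V₂ at *
  rw [sub_eq_iff_eq_add] at e1
  subst e1
  rw [sub_sub, sub_eq_iff_eq_add] at e2
  subst e2
  rw [sub_sub, sub_eq_iff_eq_add] at e3
  rw [e3, rkMap_apply]
  simp only [map_add, map_smul]
  module

/-- The upwind flux dissipates energy through the jumps at the cell interfaces. -/
lemma inner_dgOp_self_nonpos (M : Mesh N) {k : ℕ} {τ : ℝ} (hτ : 0 ≤ τ) {Q : Fin N → ℝ[X]}
    (hQ : Q ∈ DGSpace N k) :
    inner ℝ (meshVec M k (dgOp k (fun j => τ / M.width j) Q)) (meshVec M k Q) ≤ 0 := by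
  rw [inner_meshVec M (dgOp_mem _ hQ) hQ]
  have hterm : ∀ j, M.width j * unitInt (dgOp k (fun j => τ / M.width j) Q j * Q j) =
      τ / 2 * ((Q (j - 1)).eval 1 ^ 2 - (Q j).eval 1 ^ 2
        - ((Q (j - 1)).eval 1 - (Q j).eval 0) ^ 2) := by
    intro j
    have hparts := unitInt_derivative (Q j * Q j)
    rw [derivative_mul, map_add, mul_comm (derivative (Q j)), eval_mul, eval_mul] at hparts
    rw [unitInt_dgOp_mul _ _ _ (hQ j), ← mul_assoc, mul_div_cancel₀ _ (M.width_pos j).ne']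
    linear_combination τ / 2 * hparts
  have hshift : ∑ j : Fin N, (Q (j - 1)).eval 1 ^ 2 = ∑ j, (Q j).eval 1 ^ 2 :=
    (Equiv.subRight (1 : Fin N)).sum_comp fun j => (Q j).eval 1 ^ 2
  rw [Finset.sum_congr rfl fun j _ => hterm j, ← Finset.mul_sum, Finset.sum_sub_distrib,
    Finset.sum_sub_distrib, hshift, sub_self, zero_sub]
  exact mul_nonpos_of_nonneg_of_nonpos (by positivity)
    (neg_nonpos.2 (Finset.sum_nonneg fun j _ => sq_nonneg _))

/-- The inverse estimate: the reference operator is bounded by the norms on a cell and on its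
left neighbour. -/
lemma exists_norm_gaussVec_dgOp_le (k : ℕ) : ∃ K : ℝ, 0 < K ∧
    ∀ (N : ℕ) [NeZero N] (a : Fin N → ℝ) (Q : Fin N → ℝ[X]), Q ∈ DGSpace N k → ∀ j, 0 ≤ a j →
      ‖gaussVec k (dgOp k a Q j)‖ ≤
        a j * K * (‖gaussVec k (Q j)‖ + ‖gaussVec k (Q (j - 1))‖) := by
  obtain ⟨K₁, hK₁, h1⟩ := exists_evalBound k
  obtain ⟨K₂, hK₂, h2⟩ := exists_norm_le_mul_norm_gaussVec k (gaussVec k ∘ₗ derivative)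
  set B := ‖gaussVec k (leftDelta k)‖
  have hB : 0 ≤ B := norm_nonneg _
  refine ⟨K₂ + K₁ * B + 1, by positivity, fun N _ a Q hQ j ha => ?_⟩
  rw [dgOp_apply, map_smul, norm_smul, Real.norm_eq_abs, abs_of_nonneg ha, mul_assoc]
  refine mul_le_mul_of_nonneg_left ?_ ha
  rw [map_add, map_neg, map_smul]
  have e1 : ‖gaussVec k (derivative (Q j))‖ ≤ K₂ * ‖gaussVec k (Q j)‖ := h2 _ (hQ j)
  have e2 := h1 _ (hQ j) 0 ⟨le_rfl, zero_le_one⟩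
  have e3 := h1 _ (hQ (j - 1)) 1 ⟨zero_le_one, le_rfl⟩
  have e4 : |(Q (j - 1)).eval 1 - (Q j).eval 0| ≤
      K₁ * (‖gaussVec k (Q j)‖ + ‖gaussVec k (Q (j - 1))‖) := by
    refine (abs_sub _ _).trans ?_
    linarith
  refine (norm_add_le _ _).trans ?_
  rw [norm_neg, norm_smul, Real.norm_eq_abs]
  have e5 := mul_le_mul_of_nonneg_right e4 hB
  nlinarith [norm_nonneg (gaussVec k (Q j)), norm_nonneg (gaussVec k (Q (j - 1)))]

end

/-! ### Stability of a step under the CFL condition -/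

section
variable {N : ℕ}

lemma Mesh.width_le_h (M : Mesh N) (j : Fin N) : M.width j ≤ M.h :=
  le_ciSup (Set.finite_range M.width).bddAbove j

variable [NeZero N]

lemma Mesh.h_pos (M : Mesh N) : 0 < M.h := (M.width_pos 0).trans_le (M.width_le_h 0)

/-- The operator `Δt L` of the scheme in reference coordinates. -/
abbrev schemeOp (M : Mesh N) (k : ℕ) (c Δt : ℝ) : (Fin N → ℝ[X]) →ₗ[ℝ] (Fin N → ℝ[X]) :=
  dgOp k fun j => c * Δt / M.width j

lemma rkMap_mem {k : ℕ} (a : Fin N → ℝ) {Q : Fin N → ℝ[X]} (hQ : Q ∈ DGSpace N k) :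
    rkMap (dgOp k a) Q ∈ DGSpace N k := by
  have h1 := dgOp_mem a hQ
  have h2 := dgOp_mem a h1
  have h3 := dgOp_mem a h2
  exact (dgSubmodule N k).add_mem ((dgSubmodule N k).add_mem ((dgSubmodule N k).add_mem hQ h1)
    ((dgSubmodule N k).smul_mem _ h2)) ((dgSubmodule N k).smul_mem _ h3)

lemma norm_meshVec_le_of_cell_bound (M : Mesh N) {k : ℕ} {ρ σ : ℝ}
    (hσ : 2 * σ ^ 2 * (1 + ρ) ≤ 1) (hρ : ∀ i j, M.width i ≤ ρ * M.width j)
    {P Q : Fin N → ℝ[X]} (h : ∀ j, ‖gaussVec k (P j)‖ ≤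
      σ * (‖gaussVec k (Q j)‖ + ‖gaussVec k (Q (j - 1))‖)) :
    ‖meshVec M k P‖ ≤ ‖meshVec M k Q‖ := by
  refine abs_le_of_sq_le_sq' ?_ (norm_nonneg _) |>.2
  rw [norm_meshVec_sq, norm_meshVec_sq]
  have hshift : ∑ j : Fin N, M.width (j - 1) * ‖gaussVec k (Q (j - 1))‖ ^ 2 =
      ∑ j, M.width j * ‖gaussVec k (Q j)‖ ^ 2 :=
    (Equiv.subRight (1 : Fin N)).sum_comp fun j => M.width j * ‖gaussVec k (Q j)‖ ^ 2
  have hcell : ∀ j, M.width j * ‖gaussVec k (P j)‖ ^ 2 ≤ 2 * σ ^ 2 *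
      (M.width j * ‖gaussVec k (Q j)‖ ^ 2 +
        ρ * (M.width (j - 1) * ‖gaussVec k (Q (j - 1))‖ ^ 2)) := by
    intro j
    set x := ‖gaussVec k (Q j)‖
    set y := ‖gaussVec k (Q (j - 1))‖
    have h1 : ‖gaussVec k (P j)‖ ^ 2 ≤ 2 * σ ^ 2 * (x ^ 2 + y ^ 2) := by
      calc ‖gaussVec k (P j)‖ ^ 2 ≤ (σ * (x + y)) ^ 2 :=
            pow_le_pow_left₀ (norm_nonneg _) (h j) 2
        _ ≤ 2 * σ ^ 2 * (x ^ 2 + y ^ 2) := by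
          nlinarith [mul_nonneg (sq_nonneg σ) (sq_nonneg (x - y))]
    have h2 := mul_le_mul_of_nonneg_left h1 (M.width_pos j).le
    have h3 := mul_le_mul_of_nonneg_right (hρ j (j - 1))
      (mul_nonneg (mul_nonneg zero_le_two (sq_nonneg σ)) (sq_nonneg y))
    calc _ ≤ _ := h2
      _ ≤ _ := by linarith
  refine (Finset.sum_le_sum fun j _ => hcell j).trans ?_
  rw [← Finset.mul_sum, Finset.sum_add_distrib, ← Finset.mul_sum, hshift]
  have hS : 0 ≤ ∑ j, M.width j * ‖gaussVec k (Q j)‖ ^ 2 :=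
    Finset.sum_nonneg fun j _ => mul_nonneg (M.width_pos j).le (sq_nonneg _)
  nlinarith

/-- A step of the scheme is bounded on each cell by the data on the cell and its three left
neighbours. -/
def StepLocallyBounded (M : Mesh N) (k : ℕ) (c Δt : ℝ) : Prop :=
  ∀ Q ∈ DGSpace N k, ∀ (j : Fin N) (ε : ℝ), ‖gaussVec k (Q j)‖ ≤ ε →
    ‖gaussVec k (Q (j - 1))‖ ≤ ε → ‖gaussVec k (Q (j - 1 - 1))‖ ≤ ε →
    ‖gaussVec k (Q (j - 1 - 1 - 1))‖ ≤ ε →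
    ‖gaussVec k (rkMap (schemeOp M k c Δt) Q j)‖ ≤ 3 * ε

/-- Under the CFL condition a step moves by less than a cell, is a contraction in `L²`, and is
locally bounded. -/
theorem exists_cfl (k : ℕ) {c : ℝ} (hc : 0 < c) (ρ : ℝ) : ∃ C₀ : ℝ, 0 < C₀ ∧
    ∀ (N : ℕ) [NeZero N] (M : Mesh N) (Δt : ℝ), M.QuasiUniform ρ → 0 < Δt → Δt ≤ C₀ * M.h →
      (∀ j, c * Δt ≤ M.width j) ∧
      (∀ Q ∈ DGSpace N k, ‖meshVec M k (rkMap (schemeOp M k c Δt) Q)‖ ≤ ‖meshVec M k Q‖) ∧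
      StepLocallyBounded M k c Δt := by
  obtain ⟨K, hK, hop⟩ := exists_norm_gaussVec_dgOp_le k
  set R := max ρ 1 with hR
  have hR1 : 1 ≤ R := le_max_right _ _
  -- `σ` bounds the norm of the operator on a pair of cells, whose widths differ by a factor `R`;
  -- summed over the cells this gives the squared norm `2 σ² (1 + R) ≤ 1`
  set σ := 1 / (2 * (1 + R)) with hσ
  have hσ0 : 0 < σ := by positivity
  have hσR : σ * (1 + R) = 1 / 2 := by rw [hσ]; field_simp
  have hσ4 : σ ≤ 1 / 4 := by nlinarith
  refine ⟨σ / (c * R * (K + 1)), by positivity, fun N _ M Δt hM hΔt hcfl => ?_⟩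
  have hqu : ∀ j, M.h ≤ R * M.width j := fun j =>
    (hM j).trans (mul_le_mul_of_nonneg_right (le_max_left _ _) (M.width_pos j).le)
  have ha : ∀ j, c * Δt / M.width j * (K + 1) ≤ σ := by
    intro j
    have h1 : c * Δt * R * (K + 1) ≤ σ * M.h := by
      rw [div_mul_eq_mul_div, le_div_iff₀ (by positivity)] at hcfl
      linarith
    rw [div_mul_eq_mul_div, div_le_iff₀ (M.width_pos j)]
    have h2 : R * (c * Δt * (K + 1)) ≤ R * (σ * M.width j) := by
      nlinarith [mul_le_mul_of_nonneg_left (hqu j) hσ0.le]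
    exact le_of_mul_le_mul_left h2 (by positivity)
  have ha0 : ∀ j, 0 ≤ c * Δt / M.width j := fun j =>
    div_nonneg (by positivity) (M.width_pos j).le
  have hcell : ∀ Q ∈ DGSpace N k, ∀ j, ‖gaussVec k (schemeOp M k c Δt Q j)‖ ≤
      σ * (‖gaussVec k (Q j)‖ + ‖gaussVec k (Q (j - 1))‖) := by
    intro Q hQ j
    refine (hop N _ Q hQ j (ha0 j)).trans (mul_le_mul_of_nonneg_right ?_ (by positivity))
    nlinarith [ha j, ha0 j]
  refine ⟨fun j => ?_, fun Q hQ => ?_, ?_⟩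
  · have h1 : c * Δt / M.width j ≤ 1 := by nlinarith [ha j, ha0 j]
    rwa [div_le_one (M.width_pos j)] at h1
  · refine norm_rkMap_le (schemeOp M k c Δt) (meshVec M k) (dgSubmodule N k)
      (fun v hv => dgOp_mem _ hv)
      (fun v hv => inner_dgOp_self_nonpos M (by positivity) hv) (fun v hv => ?_) hQ
    refine norm_meshVec_le_of_cell_bound M (ρ := R) ?_
      (fun i j => (M.width_le_h i).trans (hqu j)) (hcell v hv)
    nlinarith
  · intro Q hQ j ε h0 h1 h2 h3
    have hstep : ∀ P ∈ DGSpace N k, ∀ i, ‖gaussVec k (P i)‖ ≤ ε → ‖gaussVec k (P (i - 1))‖ ≤ ε →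
        ‖gaussVec k (schemeOp M k c Δt P i)‖ ≤ ε := by
      intro P hP i hi hi'
      have hε : 0 ≤ ε := (norm_nonneg _).trans hi
      refine (hcell P hP i).trans ?_
      nlinarith
    have hε : 0 ≤ ε := (norm_nonneg _).trans h0
    have hA := dgOp_mem (fun j => c * Δt / M.width j) hQ
    have hAA := dgOp_mem (fun j => c * Δt / M.width j) hA
    have a0 := hstep Q hQ j h0 h1
    have a1 := hstep Q hQ (j - 1) h1 h2
    have a2 := hstep Q hQ (j - 1 - 1) h2 h3
    have b0 := hstep _ hA j a0 a1
    have b1 := hstep _ hA (j - 1) a1 a2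
    have c0 := hstep _ hAA j b0 b1
    rw [rkMap_apply]
    simp only [Pi.add_apply, Pi.smul_apply, map_add, map_smul]
    refine (norm_add₃_le.trans (add_le_add (add_le_add (norm_add_le _ _) le_rfl) le_rfl)).trans ?_
    rw [norm_smul, norm_smul, Real.norm_of_nonneg (by norm_num : (0 : ℝ) ≤ 1 / 2),
      Real.norm_of_nonneg (by norm_num : (0 : ℝ) ≤ 1 / 6)]
    linarith

/-- On cells across which the data is one affine function, a step is exact translation. -/
lemma rkMap_dgOp_eq_of_affine {k : ℕ} {a : Fin N → ℝ} {Q : Fin N → ℝ[X]} {j : Fin N} {d : ℝ}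
    (h0 : a j • derivative (Q j) = C d) (h1 : a (j - 1) • derivative (Q (j - 1)) = C d)
    (h2 : a (j - 1 - 1) • derivative (Q (j - 1 - 1)) = C d)
    (e0 : (Q (j - 1)).eval 1 = (Q j).eval 0) (e1 : (Q (j - 1 - 1)).eval 1 = (Q (j - 1)).eval 0)
    (e2 : (Q (j - 1 - 1 - 1)).eval 1 = (Q (j - 1 - 1)).eval 0) :
    rkMap (dgOp k a) Q j = Q j - C d := by
  have A : ∀ i, a i • derivative (Q i) = C d → (Q (i - 1)).eval 1 = (Q i).eval 0 →
      dgOp k a Q i = -C d := by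
    intro i hi hi'
    rw [dgOp_apply, hi', sub_self, zero_smul, add_zero, smul_neg, hi]
  have a0 := A j h0 e0
  have a1 := A _ h1 e1
  have a2 := A _ h2 e2
  have b0 : dgOp k a (dgOp k a Q) j = 0 := by rw [dgOp_apply, a0, a1]; simp
  have b1 : dgOp k a (dgOp k a Q) (j - 1) = 0 := by rw [dgOp_apply, a1, a2]; simp
  have c0 : dgOp k a (dgOp k a (dgOp k a Q)) j = 0 := by rw [dgOp_apply, b0, b1]; simp
  rw [rkMap_apply, Pi.add_apply, Pi.add_apply, Pi.add_apply, Pi.smul_apply, Pi.smul_apply, a0, b0,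
    c0]
  simp [sub_eq_add_neg]

end

/-! ### The dynamic programming principle -/

/-- If `u` increases along a characteristic, then in every neighbourhood of that characteristic
there is a test function touching `u` from above whose derivative along characteristics is
positive. -/
lemma exists_test_of_lt {c t₁ t₂ t₃ y₀ r : ℝ} (h12 : t₁ < t₂) (h23 : t₂ < t₃) (hr : 0 < r)
    {u : ℝ × ℝ → ℝ}
    (hu : ContinuousOn (fun q : ℝ × ℝ => u (q.1, q.2 + c * q.1))
      (Set.Icc t₁ t₃ ×ˢ Set.Icc (y₀ - r) (y₀ + r)))
    (hlt : u (t₁, y₀ + c * t₁) < u (t₂, y₀ + c * t₂)) :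
    ∃ φ : ℝ × ℝ → ℝ, ContDiff ℝ 1 φ ∧ ∃ t x : ℝ, t ∈ Set.Ioo t₁ t₃ ∧
      x - c * t ∈ Set.Ioo (y₀ - r) (y₀ + r) ∧ IsLocalMax (fun q => u q - φ q) (t, x) ∧
      0 < fderiv ℝ φ (t, x) (1, 0) + c * fderiv ℝ φ (t, x) (0, 1) := by
  set F : ℝ × ℝ → ℝ := fun q => u (q.1, q.2 + c * q.1) with hF
  set e := (u (t₂, y₀ + c * t₂) - u (t₁, y₀ + c * t₁)) / 4 with he
  have he0 : 0 < e := by rw [he]; linarith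
  -- shrink the box so that `u` stays small on its initial face
  obtain ⟨r', hr', hr'r, hface⟩ : ∃ r' > 0, r' ≤ r ∧ ∀ y ∈ Set.Icc (y₀ - r') (y₀ + r'),
      F (t₁, y) < F (t₁, y₀) + e := by
    have hcont := hu (t₁, y₀) ⟨⟨le_rfl, by linarith⟩, ⟨by linarith, by linarith⟩⟩
    obtain ⟨d, hd, hball⟩ := Metric.continuousWithinAt_iff.1 hcont e he0
    refine ⟨min r (d / 2), lt_min hr (by linarith), min_le_left _ _, fun y hy => ?_⟩
    have h1 := min_le_left r (d / 2)
    have h2 := min_le_right r (d / 2)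
    have h3 : dist (F (t₁, y)) (F (t₁, y₀)) < e := by
      refine hball ⟨⟨le_rfl, by linarith⟩, ⟨by linarith [hy.1], by linarith [hy.2]⟩⟩ ?_
      rw [Prod.dist_eq, dist_self, Real.dist_eq]
      refine max_lt hd (abs_lt.2 ⟨?_, ?_⟩) <;> linarith [hy.1, hy.2]
    rw [Real.dist_eq] at h3
    linarith [(abs_lt.1 h3).2]
  set B := Set.Icc t₁ t₃ ×ˢ Set.Icc (y₀ - r') (y₀ + r') with hB
  have hBc : IsCompact B := isCompact_Icc.prod isCompact_Icc
  have huB : ContinuousOn F B := hu.mono (Set.prod_mono le_rfl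
    (Set.Icc_subset_Icc (by linarith) (by linarith)))
  obtain ⟨m, hm⟩ := hBc.exists_bound_of_continuousOn huB
  have hm' : ∀ q ∈ B, |F q| ≤ m := hm
  have hq2 : (t₂, y₀) ∈ B := ⟨⟨h12.le, h23.le⟩, ⟨by linarith, by linarith⟩⟩
  have hm0 : 0 ≤ m := (abs_nonneg _).trans (hm' _ hq2)
  -- the exponential penalizes the final face, the square the lateral faces
  set lam := (2 * m + e) / (e * (t₃ - t₂)) with hlam
  have h32 : 0 < t₃ - t₂ := by linarith
  have hlam0 : 0 < lam := by positivity
  set K := (2 * m + 2 * e) / r' ^ 2 with hK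
  have hK0 : 0 < K := by positivity
  set φ : ℝ × ℝ → ℝ := fun q =>
    e * Real.exp (lam * (q.1 - t₂)) + K * (q.2 - c * q.1 - y₀) ^ 2 with hφ
  have hφC : ContDiff ℝ 1 φ := by fun_prop
  set Φ : ℝ × ℝ → ℝ := fun q => e * Real.exp (lam * (q.1 - t₂)) + K * (q.2 - y₀) ^ 2 with hΦ
  have hΦc : Continuous Φ := by fun_prop
  obtain ⟨⟨t, y⟩, hqB, hmax⟩ := hBc.exists_isMaxOn ⟨_, hq2⟩ (huB.sub hΦc.continuousOn)
  have hge : F (t₂, y₀) - e ≤ F (t, y) - Φ (t, y) := by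
    have := hmax hq2
    simpa [hΦ] using this
  have hF2 := (abs_le.1 (hm' _ hq2)).1
  have hFq := (abs_le.1 (hm' _ hqB)).2
  have hexp := Real.exp_pos (lam * (t - t₂))
  have hsq : 0 ≤ K * (y - y₀) ^ 2 := by positivity
  have hΦq : Φ (t, y) = e * Real.exp (lam * (t - t₂)) + K * (y - y₀) ^ 2 := rfl
  have heexp : 0 < e * Real.exp (lam * (t - t₂)) := by positivity
  obtain ⟨⟨ht1, ht3⟩, hy⟩ := hqB
  simp only at ht1 ht3 hy
  have hFd : F (t₂, y₀) - F (t₁, y₀) = 4 * e := by simp only [hF, he]; ring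
  have ht1' : t₁ < t := by
    refine lt_of_le_of_ne ht1 fun h => ?_
    subst h
    have := hface y hy
    linarith
  have ht3' : t < t₃ := by
    refine lt_of_le_of_ne ht3 fun h => ?_
    subst h
    have h1 := Real.add_one_le_exp (lam * (t - t₂))
    have h2 : e * (lam * (t - t₂)) = 2 * m + e := by rw [hlam]; field_simp
    nlinarith
  have hlat : (y - y₀) ^ 2 < r' ^ 2 := by
    by_contra! hcon
    have h1 : K * r' ^ 2 = 2 * m + 2 * e := by rw [hK]; field_simp
    have h2 := mul_le_mul_of_nonneg_left hcon hK0.le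
    linarith
  have hyr := abs_lt_of_sq_lt_sq' hlat hr'.le
  refine ⟨φ, hφC, t, y + c * t, ⟨ht1', ht3'⟩, ?_, ?_, ?_⟩
  · rw [add_sub_cancel_right]
    exact ⟨by linarith [hyr.1], by linarith [hyr.2]⟩
  · have hBn : B ∈ nhds (t, y) := prod_mem_nhds (Icc_mem_nhds ht1' ht3')
      (Icc_mem_nhds (by linarith [hyr.1]) (by linarith [hyr.2]))
    have hψ : Continuous fun q : ℝ × ℝ => (q.1, q.2 - c * q.1) := by fun_prop
    have htend : Filter.Tendsto (fun q : ℝ × ℝ => (q.1, q.2 - c * q.1)) (nhds (t, y + c * t))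
        (nhds (t, y)) := by
      have := hψ.tendsto (t, y + c * t)
      simpa using this
    filter_upwards [htend hBn] with q hq
    have := hmax hq
    simpa [hF, hΦ, hφ] using this
  · have hd : HasDerivAt (fun s : ℝ => φ (t + s, y + c * t + c * s))
        (fderiv ℝ φ (t, y + c * t) (1, c)) 0 := by
      have hline : HasDerivAt (fun s : ℝ => (t + s, y + c * t + c * s)) ((1 : ℝ), c) 0 := by
        refine HasDerivAt.prodMk ((hasDerivAt_id (0 : ℝ)).const_add t) ?_
        simpa using ((hasDerivAt_id (0 : ℝ)).const_mul c).const_add (y + c * t)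
      have hφd : HasFDerivAt φ (fderiv ℝ φ (t, y + c * t)) (t + 0, y + c * t + c * 0) := by
        rw [add_zero, mul_zero, add_zero]
        exact (hφC.differentiable one_ne_zero _).hasFDerivAt
      exact hφd.comp_hasDerivAt (0 : ℝ) hline
    have hd' : HasDerivAt (fun s : ℝ => φ (t + s, y + c * t + c * s))
        (e * (Real.exp (lam * (t - t₂)) * lam)) 0 := by
      have hfun : (fun s : ℝ => φ (t + s, y + c * t + c * s)) =
          fun s => e * Real.exp (lam * (t + s - t₂)) + K * (y - y₀) ^ 2 := by
        funext s; simp only [hφ]; ring_nf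
      rw [hfun]
      have h1 : HasDerivAt (fun s : ℝ => lam * (t + s - t₂)) lam 0 := by
        simpa using (((hasDerivAt_id (0 : ℝ)).const_add t).sub_const t₂).const_mul lam
      simpa using ((h1.exp).const_mul e).add_const (K * (y - y₀) ^ 2)
    have h2 : fderiv ℝ φ (t, y + c * t) (1, c) =
        fderiv ℝ φ (t, y + c * t) (1, 0) + c * fderiv ℝ φ (t, y + c * t) (0, 1) := by
      have h3 : ((1 : ℝ), c) = (1, 0) + c • (0, 1) := by simp
      rw [h3, map_add, map_smul, smul_eq_mul]
    rw [← h2, hd.unique hd']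
    positivity

lemma exists_maxObstacle_eq {c : ℝ} {g : ℝ → ℝ} (hg : Continuous g) {s : ℝ} (hs : 0 ≤ s) (x : ℝ) :
    ∃ θ ∈ Set.Icc 0 s, maxObstacle c g s x = g (x - c * θ) ∧
      ∀ θ' ∈ Set.Icc 0 s, g (x - c * θ') ≤ g (x - c * θ) := by
  obtain ⟨θ, hθ, heq, hmax⟩ := isCompact_Icc.exists_sSup_image_eq_and_ge
    (Set.nonempty_Icc.2 hs) (f := fun θ => g (x - c * θ)) (by fun_prop)
  exact ⟨θ, hθ, heq, hmax⟩

namespace IsViscositySolution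
variable {c : ℝ} {g u₀ : ℝ → ℝ} {u : ℝ → ℝ → ℝ}

/-- `u` in the coordinates that move with the characteristics. -/
lemma continuousOn_char (hu : IsViscositySolution c g u₀ u) :
    ContinuousOn (fun q : ℝ × ℝ => u q.1 (q.2 + c * q.1)) {q | 0 ≤ q.1} :=
  hu.continuousOn.comp (f := fun q : ℝ × ℝ => (q.1, q.2 + c * q.1))
    (by fun_prop) fun _ hq => hq

lemma continuousOn_box (hu : IsViscositySolution c g u₀ u) {t₁ t₃ a b : ℝ} (h : 0 ≤ t₁) :
    ContinuousOn (fun q : ℝ × ℝ => u q.1 (q.2 + c * q.1)) (Set.Icc t₁ t₃ ×ˢ Set.Icc a b) :=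
  hu.continuousOn_char.mono fun _ hq => h.trans hq.1.1

lemma continuous_space (hu : IsViscositySolution c g u₀ u) {t : ℝ} (ht : 0 ≤ t) :
    Continuous (u t) := by
  rw [← continuousOn_univ]
  exact hu.continuousOn.comp (f := fun x => (t, x)) (by fun_prop) fun _ _ => ht

/-- A viscosity supersolution does not decrease along characteristics. -/
lemma le_of_le (hu : IsViscositySolution c g u₀ u) (y : ℝ) {t₁ t₂ : ℝ} (h0 : 0 ≤ t₁)
    (h12 : t₁ ≤ t₂) : u t₁ (y + c * t₁) ≤ u t₂ (y + c * t₂) := by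
  by_contra! hlt
  have h12' : t₁ < t₂ := lt_of_le_of_ne h12 (by rintro rfl; exact lt_irrefl _ hlt)
  obtain ⟨φ, hφ, t, x, ht, -, hmax, hpos⟩ := exists_test_of_lt (c := c) (y₀ := y) (r := 1) h12'
    (lt_add_one t₂) one_pos (u := fun q => -u q.1 q.2) (hu.continuousOn_box h0).neg
    (neg_lt_neg hlt)
  have hmin : IsLocalMin (fun q : ℝ × ℝ => u q.1 q.2 - (-φ) q) (t, x) := by
    filter_upwards [hmax] with q hq
    simp only [Pi.neg_apply]
    linarith
  have h := (hu.supersolution (-φ) hφ.neg t x (h0.trans_lt ht.1) hmin).trans (min_le_left _ _)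
  rw [fderiv_neg] at h
  simp only [neg_apply] at h
  linarith

/-- An open condition on `u - g` at a point persists near the characteristic through it, for a short
time. -/
lemma exists_box (hu : IsViscositySolution c g u₀ u) (hg : Continuous g) {t y : ℝ} (ht : 0 ≤ t)
    {s : Set ℝ} (hs : IsOpen s) (hmem : u t (y + c * t) - g (y + c * t) ∈ s) :
    ∃ r > 0, ∀ t' x', t ≤ t' → t' < t + r → x' - c * t' ∈ Set.Ioo (y - r) (y + r) →
      u t' x' - g x' ∈ s := by
  have hcont : ContinuousOn (fun q : ℝ × ℝ => u q.1 (q.2 + c * q.1) - g (q.2 + c * q.1))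
      {q | 0 ≤ q.1} := hu.continuousOn_char.sub (by fun_prop)
  have h := (hcont (t, y) ht) (hs.mem_nhds hmem)
  obtain ⟨r, hr, hball⟩ := Metric.mem_nhdsWithin_iff.1 h
  refine ⟨r, hr, fun t' x' h1 h2 h3 => ?_⟩
  have hin : (t', x' - c * t') ∈ Metric.ball (t, y) r ∩ {q : ℝ × ℝ | 0 ≤ q.1} := by
    refine ⟨?_, ht.trans h1⟩
    rw [Metric.mem_ball, Prod.dist_eq, Real.dist_eq, Real.dist_eq]
    refine max_lt (abs_lt.2 ⟨?_, ?_⟩) (abs_lt.2 ⟨?_, ?_⟩) <;> simp only <;>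
      linarith [h3.1, h3.2]
  simpa using hball hin

/-- A viscosity supersolution stays above the obstacle. -/
lemma obstacle_le (hu : IsViscositySolution c g u₀ u) (hg : Continuous g) {t : ℝ} (ht : 0 ≤ t)
    (x : ℝ) : g x ≤ u t x := by
  by_contra! hlt
  set y := x - c * t with hy
  have hx : y + c * t = x := by rw [hy]; ring
  obtain ⟨r, hr, hbox⟩ := hu.exists_box hg (y := y) ht isOpen_Iio
    (show u t (y + c * t) - g (y + c * t) ∈ Set.Iio 0 by rw [hx]; exact sub_neg.2 hlt)
  -- the slope of the added linear function exceeds the growth of `u` on `[t, t + r/2]`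
  set Λ := (u (t + r / 2) (y + c * (t + r / 2)) - u t (y + c * t) + 1) / (r / 2) with hΛ
  have hΛr : Λ * (r / 2) = u (t + r / 2) (y + c * (t + r / 2)) - u t (y + c * t) + 1 := by
    rw [hΛ]; field_simp
  obtain ⟨φ, hφ, t', x', ht', hx', hmax, -⟩ := exists_test_of_lt (c := c) (y₀ := y) (r := r / 2)
    (t₁ := t) (t₂ := t + r / 2) (t₃ := t + r) (by linarith) (by linarith) (by linarith)
    (u := fun q => -u q.1 q.2 + Λ * q.1)
    ((hu.continuousOn_box ht).neg.add (by fun_prop)) (by simp only; linarith)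
  have hmin : IsLocalMin (fun q : ℝ × ℝ => u q.1 q.2 - (Λ * q.1 - φ q)) (t', x') := by
    filter_upwards [hmax] with q hq
    linarith
  have h := (hu.supersolution (fun q => Λ * q.1 - φ q) (by fun_prop) t' x' (ht.trans_lt ht'.1)
    hmin).trans (min_le_right _ _)
  have h2 : u t' x' - g x' < 0 :=
    hbox t' x' ht'.1.le ht'.2 ⟨by linarith [hx'.1], by linarith [hx'.2]⟩
  linarith

/-- A viscosity subsolution cannot grow along a characteristic above the values of the obstacle. -/
lemma le_of_obstacle_le (hu : IsViscositySolution c g u₀ u) (hg : Continuous g) {t s y m : ℝ}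
    (ht : 0 ≤ t) (hs : 0 ≤ s) (h0 : u t (y + c * t) ≤ m)
    (hm : ∀ τ ∈ Set.Icc t (t + s), g (y + c * τ) ≤ m) : u (t + s) (y + c * (t + s)) ≤ m := by
  refine le_of_forall_gt_imp_ge_of_dense fun m' hm' => ?_
  have hf : ContinuousOn (fun τ => u τ (y + c * τ)) (Set.Ici 0) :=
    hu.continuousOn_char.comp (f := fun τ => (τ, y)) (by fun_prop) fun _ h => h
  have hfI : ContinuousOn (fun τ => u τ (y + c * τ)) (Set.Icc t (t + s)) :=
    hf.mono fun τ hτ => ht.trans hτ.1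
  -- continuous induction along the characteristic
  refine (IsClosed.Icc_subset_of_forall_mem_nhdsWithin (s := {τ | u τ (y + c * τ) ≤ m'}) ?_
    (h0.trans hm'.le) ?_) ⟨by linarith, le_rfl⟩
  · have := hfI.preimage_isClosed_of_isClosed isClosed_Icc (isClosed_Iic (a := m'))
    rwa [Set.inter_comm] at this
  · rintro τ ⟨hτm, hτ⟩
    have hτ0 : 0 ≤ τ := ht.trans hτ.1
    rcases lt_or_eq_of_le (show u τ (y + c * τ) ≤ m' from hτm) with hlt | heq
    · have h1 := (hf τ hτ0).mono_left
        (nhdsWithin_mono τ (show Set.Ioi τ ⊆ Set.Ici 0 from fun z hz => hτ0.trans (le_of_lt hz)))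
      filter_upwards [h1 (isOpen_Iio.mem_nhds hlt)] with z hz using le_of_lt hz
    · have hpos : u τ (y + c * τ) - g (y + c * τ) ∈ Set.Ioi 0 := by
        rw [Set.mem_Ioi, heq]
        linarith [hm τ ⟨hτ.1, hτ.2.le⟩]
      obtain ⟨r, hr, hbox⟩ := hu.exists_box hg hτ0 isOpen_Ioi hpos
      filter_upwards [Ioo_mem_nhdsGT (show τ < τ + r by linarith)] with z hz
      rw [← heq]
      by_contra! hlt
      obtain ⟨φ, hφ, t', x', ht', hx', hmax, hder⟩ := exists_test_of_lt (c := c) (y₀ := y) hz.1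
        hz.2 hr (u := fun q => u q.1 q.2) (hu.continuousOn_box hτ0) hlt
      have h := hu.subsolution φ hφ t' x' (hτ0.trans_lt ht'.1) hmax
      have hg' : 0 < u t' x' - g x' := hbox t' x' ht'.1.le ht'.2 hx'
      exact absurd h (not_le.2 (lt_min hder hg'))

/-- The dynamic programming principle: the solution at the later time is the larger of the value
transported along the characteristic and the maximum of the obstacle on it. -/
theorem eq_max (hu : IsViscositySolution c g u₀ u) (hg : Continuous g) {t s : ℝ} (ht : 0 ≤ t)
    (hs : 0 ≤ s) (x : ℝ) : u (t + s) x = max (u t (x - c * s)) (maxObstacle c g s x) := by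
  obtain ⟨θ, hθ, heq, hmax⟩ := exists_maxObstacle_eq (c := c) hg hs x
  set y := x - c * (t + s) with hy
  have e1 : y + c * (t + s) = x := by rw [hy]; ring
  have e2 : y + c * t = x - c * s := by rw [hy]; ring
  have e3 : y + c * (t + s - θ) = x - c * θ := by rw [hy]; ring
  rw [heq]
  refine le_antisymm ?_ (max_le ?_ ?_)
  · rw [← e1]
    refine hu.le_of_obstacle_le hg ht hs ?_ fun τ hτ => ?_
    · rw [e1, e2]; exact le_max_left _ _
    · have := hmax (t + s - τ) ⟨by linarith [hτ.2], by linarith [hτ.1]⟩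
      rw [e1]
      refine le_trans ?_ (this.trans (le_max_right _ _))
      exact le_of_eq (congrArg g (by rw [hy]; ring))
  · have := hu.le_of_le y ht (show t ≤ t + s by linarith)
    rwa [e1, e2] at this
  · have h1 : 0 ≤ t + s - θ := by linarith [hθ.2]
    have := hu.le_of_le y h1 (show t + s - θ ≤ t + s by linarith [hθ.1])
    rw [e1, e3] at this
    exact (hu.obstacle_le hg h1 _).trans this

end IsViscositySolution

/-! ### Affine approximation between kinks -/

lemma hasDerivAt_iteratedDeriv {s : Set ℝ} (hs : IsOpen s) {j n : ℕ} (hj : j < n) {f : ℝ → ℝ}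
    (hf : ContDiffOn ℝ n f s) {x : ℝ} (hx : x ∈ s) :
    HasDerivAt (iteratedDeriv j f) (iteratedDeriv (j + 1) f x) x := by
  induction j generalizing f n with
  | zero =>
    rw [iteratedDeriv_zero, zero_add, iteratedDeriv_one]
    exact ((hf.differentiableOn (by exact_mod_cast hj.ne')).differentiableAt
      (hs.mem_nhds hx)).hasDerivAt
  | succ j ih =>
    obtain ⟨n, rfl⟩ : ∃ m, n = m + 1 := ⟨n - 1, by omega⟩
    rw [iteratedDeriv_succ', iteratedDeriv_succ' (n := j + 1)]
    exact ih (n := n) (by omega) (hf.deriv_of_isOpen hs (by norm_cast))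

/-- A slope of `f` is a value of its derivative, on an open interval where `f'` exists. -/
lemma exists_slope_eq {f f' : ℝ → ℝ} {a b : ℝ}
    (hf : ∀ x ∈ Set.Ioo a b, HasDerivAt f (f' x) x) {x y : ℝ} (hx : x ∈ Set.Ioo a b)
    (hy : y ∈ Set.Ioo a b) :
    ∃ z ∈ Set.Ioo a b, |z - y| ≤ |x - y| ∧ f x - f y = f' z * (x - y) := by
  have aux : ∀ p q, p ∈ Set.Ioo a b → q ∈ Set.Ioo a b → p < q →
      ∃ z ∈ Set.Ioo p q, f q - f p = f' z * (q - p) := by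
    intro p q hp hq hpq
    have hsub : ∀ z ∈ Set.Icc p q, z ∈ Set.Ioo a b :=
      fun z hz => ⟨hp.1.trans_le hz.1, hz.2.trans_lt hq.2⟩
    obtain ⟨z, hz, hzeq⟩ := exists_hasDerivAt_eq_slope f f' hpq
      (fun z hz => (hf z (hsub z hz)).continuousAt.continuousWithinAt)
      (fun z hz => hf z (hsub z (Set.Ioo_subset_Icc_self hz)))
    refine ⟨z, hz, ?_⟩
    rw [hzeq, div_mul_cancel₀ _ (sub_pos.2 hpq).ne']
  rcases lt_trichotomy x y with h | rfl | h
  · obtain ⟨z, hz, hzeq⟩ := aux x y hx hy h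
    refine ⟨z, ⟨hx.1.trans hz.1, hz.2.trans hy.2⟩, ?_, by linarith⟩
    rw [abs_of_neg (by linarith [hz.2]), abs_of_neg (by linarith)]
    linarith [hz.1]
  · exact ⟨x, hx, le_rfl, by simp⟩
  · obtain ⟨z, hz, hzeq⟩ := aux y x hy hx h
    refine ⟨z, ⟨hy.1.trans hz.1, hz.2.trans hx.2⟩, ?_, hzeq⟩
    rw [abs_of_pos (by linarith [hz.1]), abs_of_pos (by linarith)]
    linarith [hz.2]

/-- Every derivative of a bounded function is small at some point of a given interval. -/
lemma exists_abs_iteratedDeriv_le (j : ℕ) : ∃ K : ℝ, 0 ≤ K ∧ ∀ (f : ℝ → ℝ) (a b A : ℝ), a < b →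
    ContDiffOn ℝ j f (Set.Ioo a b) → (∀ x ∈ Set.Ioo a b, |f x| ≤ A) →
    ∃ x ∈ Set.Ioo a b, |iteratedDeriv j f x| * (b - a) ^ j ≤ K * A := by
  induction j with
  | zero =>
    refine ⟨1, zero_le_one, fun f a b A hab _ hA => ⟨(a + b) / 2, ?_, ?_⟩⟩
    · constructor <;> linarith
    · simpa using hA ((a + b) / 2) ⟨by linarith, by linarith⟩
  | succ j ih =>
    obtain ⟨K, hK, hj⟩ := ih
    refine ⟨2 * 3 ^ (j + 1) * K, by positivity, fun f a b A hab hf hA => ?_⟩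
    -- compare the points found in the left and in the right third of the interval
    set d := (b - a) / 3 with hd
    have hd0 : 0 < d := by rw [hd]; linarith
    have hf' : ContDiffOn ℝ j f (Set.Ioo a b) := hf.of_le (by norm_cast; omega)
    have hs1 : Set.Ioo a (a + d) ⊆ Set.Ioo a b := Set.Ioo_subset_Ioo le_rfl (by linarith)
    have hs2 : Set.Ioo (b - d) b ⊆ Set.Ioo a b := Set.Ioo_subset_Ioo (by linarith) le_rfl
    obtain ⟨y, hy, hyb⟩ := hj f a (a + d) A (by linarith) (hf'.mono hs1)
      (fun x hx => hA x (hs1 hx))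
    obtain ⟨x, hx, hxb⟩ := hj f (b - d) b A (by linarith) (hf'.mono hs2)
      (fun x hx => hA x (hs2 hx))
    obtain ⟨z, hz, -, hzeq⟩ := exists_slope_eq (f := iteratedDeriv j f)
      (fun w hw => hasDerivAt_iteratedDeriv isOpen_Ioo (Nat.lt_succ_self j) hf hw)
      (hs2 hx) (hs1 hy)
    refine ⟨z, hz, ?_⟩
    rw [add_sub_cancel_left] at hyb
    rw [sub_sub_cancel] at hxb
    have hxy : d ≤ x - y := by linarith [hx.1, hy.2]
    have h1 : |iteratedDeriv (j + 1) f z| * d ≤ |iteratedDeriv j f x| + |iteratedDeriv j f y| := by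
      calc _ ≤ |iteratedDeriv (j + 1) f z| * |x - y| :=
            mul_le_mul_of_nonneg_left (hxy.trans (le_abs_self _)) (abs_nonneg _)
        _ = |iteratedDeriv j f x - iteratedDeriv j f y| := by rw [hzeq, abs_mul]
        _ ≤ _ := abs_sub _ _
    have h2 : |iteratedDeriv (j + 1) f z| * d ^ (j + 1) ≤ 2 * K * A := by
      have := mul_le_mul_of_nonneg_right h1 (pow_nonneg hd0.le j)
      rw [pow_succ]
      linarith
    have h3 : (b - a) ^ (j + 1) = 3 ^ (j + 1) * d ^ (j + 1) := by
      rw [← mul_pow, hd]; congr 1; ring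
    rw [h3]
    have h4 := mul_le_mul_of_nonneg_left h2 (pow_nonneg (zero_le_three (α := ℝ)) (j + 1))
    linarith

/-- A Landau–Kolmogorov inequality: the first derivative is controlled by the function and by a
higher derivative, with the scaling of the interval. -/
lemma exists_abs_deriv_le {n : ℕ} (hn : 1 ≤ n) (A B : ℝ) : ∃ C : ℝ,
    ∀ (f : ℝ → ℝ) (a b : ℝ), a < b → ContDiffOn ℝ n f (Set.Ioo a b) →
    (∀ x ∈ Set.Ioo a b, |f x| ≤ A) →
    (∀ x ∈ Set.Ioo a b, |iteratedDeriv n f x| * (b - a) ^ n ≤ B) →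
    ∀ x ∈ Set.Ioo a b, |deriv f x| * (b - a) ≤ C := by
  induction n, hn using Nat.le_induction generalizing B with
  | base =>
    refine ⟨B, fun f a b _ _ _ h x hx => ?_⟩
    have := h x hx
    rwa [iteratedDeriv_one, pow_one] at this
  | succ n hn ih =>
    obtain ⟨K, hK, hpt⟩ := exists_abs_iteratedDeriv_le n
    obtain ⟨C, hC⟩ := ih (K * A + B)
    refine ⟨C, fun f a b hab hf hA hB => ?_⟩
    have hf' : ContDiffOn ℝ n f (Set.Ioo a b) := hf.of_le (by norm_cast; omega)
    refine hC f a b hab hf' hA fun x hx => ?_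
    obtain ⟨y, hy, hyb⟩ := hpt f a b A hab hf' hA
    obtain ⟨z, hz, -, hzeq⟩ := exists_slope_eq (f := iteratedDeriv n f)
      (fun w hw => hasDerivAt_iteratedDeriv isOpen_Ioo (Nat.lt_succ_self n) hf hw) hx hy
    have hxy : |x - y| ≤ b - a := by
      rw [abs_le]; constructor <;> linarith [hx.1, hx.2, hy.1, hy.2]
    have h1 : |iteratedDeriv n f x| ≤
        |iteratedDeriv n f y| + |iteratedDeriv (n + 1) f z| * (b - a) := by
      have h2 : |iteratedDeriv n f x - iteratedDeriv n f y| ≤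
          |iteratedDeriv (n + 1) f z| * (b - a) := by
        rw [hzeq, abs_mul]
        exact mul_le_mul_of_nonneg_left hxy (abs_nonneg _)
      have := abs_sub_abs_le_abs_sub (iteratedDeriv n f x) (iteratedDeriv n f y)
      linarith
    have h3 := mul_le_mul_of_nonneg_right h1 (pow_nonneg (sub_pos.2 hab).le n)
    have h4 := hB z hz
    rw [pow_succ] at h4
    linarith

/-- On `(a,b)` the function `f` is differentiable, and within `M (x - y) ^ 2` of its tangent at
every point `y`. -/
def TangentBound (f : ℝ → ℝ) (a b M : ℝ) : Prop :=
  ∀ y ∈ Set.Ioo a b, DifferentiableAt ℝ f y ∧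
    ∀ x ∈ Set.Ioo a b, |f x - f y - deriv f y * (x - y)| ≤ M * (x - y) ^ 2

/-- Piecewise regular functions are well approximated by their tangents on every interval free
of kinks. The constant degenerates like the inverse of the length of the interval. -/
lemma PiecewiseRegular.exists_tangentBound {m p : ℕ} (hm : 2 ≤ m) {L : ℝ} (hL : 0 ≤ L)
    (c₀ : ℝ) : ∃ C : ℝ, 0 ≤ C ∧ ∀ v : ℝ → ℝ, PiecewiseRegular m p L c₀ v →
      ∃ S : Finset ℝ, S.card ≤ p ∧ ∀ a b, 0 ≤ a → a < b → b ≤ 1 →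
        (∀ s ∈ S, s ∉ Set.Ioo a b) → TangentBound v a b (C / (b - a)) := by
  obtain ⟨n, rfl⟩ : ∃ n, m = n + 1 := ⟨m - 1, by omega⟩
  obtain ⟨C, hC⟩ := exists_abs_deriv_le (n := n) (by omega) L |c₀|
  refine ⟨|C|, abs_nonneg C, fun v ⟨hLip, S, hS, hCD, hder⟩ => ⟨S, hS, ?_⟩⟩
  intro a b ha hab hb hfree
  have hsub : Set.Ioo a b ⊆ Set.Ioo (0 : ℝ) 1 \ S :=
    fun x hx => ⟨⟨ha.trans_lt hx.1, hx.2.trans_le hb⟩, fun hxS => hfree x hxS hx⟩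
  have hCD' : ContDiffOn ℝ (n + 1 : ℕ) v (Set.Ioo a b) := hCD.mono hsub
  have hd1 : ∀ x ∈ Set.Ioo a b, HasDerivAt v (deriv v x) x := fun x hx => by
    have := hasDerivAt_iteratedDeriv isOpen_Ioo (Nat.succ_pos n) hCD' hx
    rwa [iteratedDeriv_zero, zero_add, iteratedDeriv_one] at this
  have hCD1 : ContDiffOn ℝ n (deriv v) (Set.Ioo a b) :=
    hCD'.deriv_of_isOpen isOpen_Ioo (by norm_cast)
  have hd2 : ∀ x ∈ Set.Ioo a b, HasDerivAt (deriv v) (deriv (deriv v) x) x := fun x hx => by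
    have := hasDerivAt_iteratedDeriv isOpen_Ioo (show 0 < n by omega) hCD1 hx
    rwa [iteratedDeriv_zero, zero_add, iteratedDeriv_one] at this
  have hvL : ∀ x ∈ Set.Ioo a b, |deriv v x| ≤ L := fun x hx => by
    refine norm_deriv_le_of_lip' (f := v) hL ?_
    filter_upwards [isOpen_Ioo.mem_nhds hx] with y hy
    exact hLip y (hsub hy).1 x (hsub hx).1
  have hsecond := hC (deriv v) a b hab hCD1 hvL fun x hx => by
    rw [← iteratedDeriv_succ']
    have h1 : (b - a) ^ n ≤ 1 := pow_le_one₀ (by linarith) (by linarith)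
    calc |iteratedDeriv (n + 1) v x| * (b - a) ^ n ≤ |iteratedDeriv (n + 1) v x| * 1 :=
          mul_le_mul_of_nonneg_left h1 (abs_nonneg _)
      _ ≤ |c₀| := by rw [mul_one]; exact (hder x (hsub hx)).trans (le_abs_self _)
  refine fun y hy => ⟨(hd1 y hy).differentiableAt, fun x hx => ?_⟩
  obtain ⟨z, hz, hzxy, hzeq⟩ := exists_slope_eq hd1 hx hy
  obtain ⟨w, hw, -, hweq⟩ := exists_slope_eq hd2 hz hy
  have hw' : |deriv (deriv v) w| ≤ |C| / (b - a) := by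
    rw [le_div_iff₀ (sub_pos.2 hab)]
    exact (hsecond w hw).trans (le_abs_self C)
  rw [hzeq, ← sub_mul, hweq, abs_mul, abs_mul, mul_assoc, ← sq_abs (x - y), sq]
  exact mul_le_mul hw' (mul_le_mul_of_nonneg_right hzxy (abs_nonneg _)) (by positivity)
    ((abs_nonneg _).trans hw')

/-- A continuous periodic function that is Lipschitz on the open period is Lipschitz at distances
up to one. -/
lemma abs_sub_le_of_periodic {f : ℝ → ℝ} {L : ℝ} (hf : Continuous f) (hper : Function.Periodic f 1)
    (hLip : ∀ x ∈ Set.Ioo (0 : ℝ) 1, ∀ y ∈ Set.Ioo (0 : ℝ) 1, |f x - f y| ≤ L * |x - y|)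
    (x y : ℝ) (hxy : |x - y| ≤ 1) : |f x - f y| ≤ L * |x - y| := by
  have hcl : ∀ q ∈ Set.Icc (0 : ℝ) 1 ×ˢ Set.Icc (0 : ℝ) 1,
      |f q.1 - f q.2| ≤ L * |q.1 - q.2| := by
    rw [← closure_Ioo (zero_ne_one (α := ℝ)), ← closure_prod_eq]
    refine closure_minimal (t := {q : ℝ × ℝ | |f q.1 - f q.2| ≤ L * |q.1 - q.2|}) ?_ ?_
    · rintro ⟨p, q⟩ ⟨hp, hq⟩
      exact hLip p hp q hq
    · exact isClosed_le (by fun_prop) (by fun_prop)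
  have hshift : ∀ (n : ℤ) (z : ℝ), f (z - n) = f z := fun n z => by
    simpa using hper.sub_zsmul_eq n (x := z)
  have hunit : ∀ (n : ℤ) (p q : ℝ), (n : ℝ) ≤ p → p ≤ n + 1 → (n : ℝ) ≤ q → q ≤ n + 1 →
      |f p - f q| ≤ L * |p - q| := by
    intro n p q h1 h2 h3 h4
    have := hcl (p - n, q - n) ⟨⟨by linarith, by linarith⟩, ⟨by linarith, by linarith⟩⟩
    simpa [hshift] using this
  wlog h : x ≤ y generalizing x y
  · have := this y x (by rwa [abs_sub_comm]) (by linarith)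
    rwa [abs_sub_comm, abs_sub_comm x y]
  have hx1 := Int.floor_le x
  have hx2 := (Int.lt_floor_add_one x).le
  rw [abs_le] at hxy
  rcases le_total y (⌊x⌋ + 1) with hy | hy
  · exact hunit ⌊x⌋ x y hx1 hx2 (by linarith) hy
  · have h1 := hunit ⌊x⌋ x (⌊x⌋ + 1) hx1 hx2 (by linarith) le_rfl
    have h2 := hunit (⌊x⌋ + 1) (⌊x⌋ + 1) y (by push_cast; exact le_rfl) (by push_cast; linarith)
      (by push_cast; exact hy) (by push_cast; linarith)
    rw [abs_of_nonpos (show x - (⌊x⌋ + 1) ≤ 0 by linarith)] at h1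
    rw [abs_of_nonpos (show (⌊x⌋ : ℝ) + 1 - y ≤ 0 by linarith)] at h2
    rw [abs_of_nonpos (show x - y ≤ 0 by linarith)]
    have h3 := abs_sub_le (f x) (f (⌊x⌋ + 1)) (f y)
    linarith

lemma PiecewiseRegular.lipschitz_const_nonneg {m p : ℕ} {L c₀ : ℝ} {v : ℝ → ℝ}
    (h : PiecewiseRegular m p L c₀ v) : 0 ≤ L := by
  have h1 := h.1 (1 / 4) (by constructor <;> norm_num) (3 / 4) (by constructor <;> norm_num)
  have h2 := (abs_nonneg _).trans h1
  norm_num at h2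
  exact h2

/-! ### The obstacle values -/

/-- Both choices of the obstacle values lie between `max (g x) (g (x - c s))` and the exact
maximum. -/
lemma obstacle_bounds {c s : ℝ} {g gt : ℝ → ℝ} (hg : Continuous g) (hs : 0 ≤ s)
    (hgt : gt = maxObstacle c g s ∨ gt = twoPointObstacle c g s) (x : ℝ) :
    twoPointObstacle c g s x ≤ gt x ∧ gt x ≤ maxObstacle c g s x := by
  obtain ⟨θ, hθ, heq, hmax⟩ := exists_maxObstacle_eq (c := c) hg hs x
  have h : twoPointObstacle c g s x ≤ maxObstacle c g s x := by
    rw [heq]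
    refine max_le ?_ (hmax s ⟨hs, le_rfl⟩)
    simpa using hmax 0 ⟨le_rfl, hs⟩
  rcases hgt with rfl | rfl
  · exact ⟨h, le_rfl⟩
  · exact ⟨le_rfl, h⟩

lemma max_obstacle_le {c s : ℝ} {f g v gt : ℝ → ℝ} (hg : Continuous g) (hs : 0 ≤ s)
    (hdpp : ∀ x, v x = max (f (x - c * s)) (maxObstacle c g s x))
    (hgt : gt = maxObstacle c g s ∨ gt = twoPointObstacle c g s) (x : ℝ) :
    max (f (x - c * s)) (gt x) ≤ v x := by
  rw [hdpp]
  exact max_le_max le_rfl (obstacle_bounds hg hs hgt x).2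

lemma sub_max_obstacle_le_lipschitz {c s L : ℝ} {f g v gt : ℝ → ℝ} (hc : 0 ≤ c)
    (hg : Continuous g) (hs : 0 ≤ s) (hfg : ∀ x, g x ≤ f x)
    (hdpp : ∀ x, v x = max (f (x - c * s)) (maxObstacle c g s x)) (hL : 0 ≤ L) (hcs : c * s ≤ 1)
    (hf : ∀ x y, |x - y| ≤ 1 → |f x - f y| ≤ L * |x - y|) (x : ℝ) :
    v x - max (f (x - c * s)) (gt x) ≤ L * (c * s) := by
  obtain ⟨θ, hθ, heq, -⟩ := exists_maxObstacle_eq (c := c) hg hs x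
  have hcθ : c * θ ≤ c * s := mul_le_mul_of_nonneg_left hθ.2 hc
  have hcθ0 : 0 ≤ c * θ := mul_nonneg hc hθ.1
  have h1 : |x - c * θ - (x - c * s)| ≤ c * s := by
    rw [abs_le]; constructor <;> linarith
  have h2 := (abs_le.1 ((hf _ _ (h1.trans hcs)).trans (mul_le_mul_of_nonneg_left h1 hL))).2
  have h3 := hfg (x - c * θ)
  have h4 := le_max_left (f (x - c * s)) (gt x)
  have h5 : 0 ≤ L * (c * s) := mul_nonneg hL (mul_nonneg hc hs)
  rw [hdpp x, heq]
  rcases max_cases (f (x - c * s)) (g (x - c * θ)) with h | h <;> linarith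

/-- Away from kinks the two-point maximum is accurate to second order. When the obstacle is
active at an interior point `z` of the characteristic segment, `v` has a local minimum at `x`, so
`v` is flat near `x`. By `f (y - c s) ≤ v y` the function `f` is then almost maximal at `z`,
hence almost flat, and the value transported from `x - c s` is almost `g z`. -/
lemma sub_max_obstacle_le_sq {c s a b M : ℝ} {f g v gt : ℝ → ℝ} (hc : 0 < c)
    (hg : Continuous g) (hs : 0 ≤ s) (hfg : ∀ x, g x ≤ f x)
    (hdpp : ∀ x, v x = max (f (x - c * s)) (maxObstacle c g s x))
    (hgt : gt = maxObstacle c g s ∨ gt = twoPointObstacle c g s) (hM : 0 ≤ M)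
    (hTf : TangentBound f a b M)
    (hTv : TangentBound v a b M) {x : ℝ} (hx1 : a < x - c * s) (hx2 : x + 2 * (c * s) < b) :
    v x - max (f (x - c * s)) (gt x) ≤ 6 * M * (c * s) ^ 2 := by
  obtain ⟨θ, hθ, heq, -⟩ := exists_maxObstacle_eq (c := c) hg hs x
  have hcs : 0 ≤ c * s := mul_nonneg hc.le hs
  have hRHS : 0 ≤ 6 * M * (c * s) ^ 2 := by positivity
  have h2pt := (obstacle_bounds hg hs hgt x).1
  by_contra! hcon
  have hlt : max (f (x - c * s)) (gt x) < v x := by linarith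
  have hf_lt : f (x - c * s) < v x := (le_max_left _ _).trans_lt hlt
  have hg_lt : gt x < v x := (le_max_right _ _).trans_lt hlt
  have hv : v x = g (x - c * θ) := by
    have := hdpp x
    rw [heq] at this
    rcases max_choice (f (x - c * s)) (g (x - c * θ)) with h | h
    · rw [h] at this; exact absurd this hf_lt.ne'
    · rw [this, h]
  set z := x - c * θ with hz
  have hz_ne : z ≠ x := fun h => by
    have : g x ≤ gt x := (le_max_left _ _).trans h2pt
    rw [h] at hv
    linarith
  have hz_ne' : z ≠ x - c * s := fun h => by
    have : g (x - c * s) ≤ gt x := (le_max_right _ _).trans h2pt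
    rw [h] at hv
    linarith
  have hzx : z < x := lt_of_le_of_ne (by rw [hz]; linarith [mul_nonneg hc.le hθ.1]) hz_ne
  have hzx' : x - c * s < z :=
    lt_of_le_of_ne (by rw [hz]; linarith [mul_le_mul_of_nonneg_left hθ.2 hc.le]) hz_ne'.symm
  -- the value `g z` is a lower bound of `v` on the cone of influence of `z`
  have hcone : ∀ y ∈ Set.Icc z (z + c * s), v x ≤ v y := by
    intro y hy
    obtain ⟨θ', -, heq', hmax'⟩ := exists_maxObstacle_eq (c := c) hg hs y
    have h1 := hmax' ((y - z) / c) ⟨div_nonneg (by linarith [hy.1]) hc.le, by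
      rw [div_le_iff₀ hc]; linarith [hy.2]⟩
    rw [mul_div_cancel₀ _ hc.ne', sub_sub_cancel, ← heq', ← hv] at h1
    rw [hdpp y]
    exact h1.trans (le_max_right _ _)
  have hderiv : deriv v x = 0 := by
    refine IsLocalMin.deriv_eq_zero ?_
    filter_upwards [Icc_mem_nhds hzx (show x < z + c * s by linarith)] with y hy using hcone y hy
  have hxI : x ∈ Set.Ioo a b := ⟨by linarith, by linarith⟩
  have hzI : z ∈ Set.Ioo a b := ⟨by linarith, by linarith⟩
  have h1 := (abs_le.1 ((hTv x hxI).2 (z + 2 * (c * s)) ⟨by linarith, by linarith⟩)).2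
  rw [hderiv, zero_mul, sub_zero] at h1
  have h2 : f (z + c * s) ≤ v (z + 2 * (c * s)) := by
    rw [hdpp]
    refine le_trans (le_of_eq (congrArg f (by ring))) (le_max_left _ _)
  have h3 := (abs_le.1 ((hTf z hzI).2 (z + c * s) ⟨by linarith, by linarith⟩)).1
  have h4 := (abs_le.1 ((hTf z hzI).2 (x - c * s) ⟨by linarith, by linarith⟩)).1
  have h5 : v x ≤ f z := hv ▸ hfg z
  have h6 : M * (z + 2 * (c * s) - x) ^ 2 ≤ M * (2 * (c * s)) ^ 2 :=
    mul_le_mul_of_nonneg_left (pow_le_pow_left₀ (by linarith) (by linarith) 2) hM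
  have hcs0 : 0 < c * s := by linarith
  have h7 : deriv f z ≤ 5 * M * (c * s) := by
    have h8 : deriv f z * (c * s) ≤ 5 * M * (c * s) * (c * s) := by
      rw [add_sub_cancel_left] at h3
      linarith
    exact le_of_mul_le_mul_right h8 hcs0
  have h9 : deriv f z * (z - (x - c * s)) ≤ 5 * M * (c * s) * (c * s) :=
    (mul_le_mul_of_nonneg_right h7 (by linarith)).trans
      (mul_le_mul_of_nonneg_left (by linarith) (by positivity))
  have h10 : M * (x - c * s - z) ^ 2 ≤ M * (c * s) ^ 2 := by
    refine mul_le_mul_of_nonneg_left ?_ hM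
    rw [← neg_sq]
    exact pow_le_pow_left₀ (by linarith) (by linarith) 2
  have h11 := le_max_left (f (x - c * s)) (gt x)
  linarith

/-! ### Summation of local errors over the cells -/

section

lemma sum_succ_sub_castSucc {N : ℕ} (x : Fin (N + 1) → ℝ) :
    ∑ j : Fin N, (x j.succ - x j.castSucc) = x (Fin.last N) - x 0 := by
  induction N with
  | zero => simp
  | succ N ih =>
    rw [Fin.sum_univ_castSucc]
    have := ih fun i => x i.castSucc
    simp only [Fin.succ_castSucc, Fin.castSucc_zero, Fin.succ_last] at this ⊢
    linarith

variable {N : ℕ}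

lemma Mesh.sum_width (M : Mesh N) : ∑ j, M.width j = 1 := by
  have := sum_succ_sub_castSucc M.node
  rw [M.node_last, M.node_zero, sub_zero] at this
  exact this

lemma Mesh.zero_le_left (M : Mesh N) (j : Fin N) : 0 ≤ M.left j := by
  rw [← M.node_zero]
  exact M.strictMono.monotone (Fin.zero_le _)

lemma Mesh.right_le_one (M : Mesh N) (j : Fin N) : M.right j ≤ 1 := by
  rw [← M.node_last]
  exact M.strictMono.monotone (Fin.le_last _)

/-- Cells contained in an interval have total length at most that of the interval. -/
lemma Mesh.sum_width_le (M : Mesh N) (F : Finset (Fin N)) {a b : ℝ} (hab : a ≤ b)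
    (hF : ∀ j ∈ F, a ≤ M.left j ∧ M.right j ≤ b) : ∑ j ∈ F, M.width j ≤ b - a := by
  set φ : ℝ → ℝ := fun x => max a (min b x) with hφ
  have hmono : Monotone φ := fun x y h => max_le_max le_rfl (min_le_min le_rfl h)
  have h1 := sum_succ_sub_castSucc fun i => φ (M.node i)
  have h2 : ∑ j ∈ F, M.width j ≤ ∑ j, (φ (M.right j) - φ (M.left j)) := by
    refine le_trans (Finset.sum_le_sum fun j hj => ?_)
      (Finset.sum_le_sum_of_subset_of_nonneg (Finset.subset_univ F)
        fun j _ _ => sub_nonneg.2 (hmono (M.left_lt_right j).le))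
    obtain ⟨h3, h4⟩ := hF j hj
    have h5 := M.left_lt_right j
    simp only [hφ, Mesh.width]
    rw [min_eq_right h4, min_eq_right (by linarith), max_eq_right h3, max_eq_right (by linarith)]
  have h3 : φ (M.node (Fin.last N)) ≤ b := max_le hab (min_le_left _ _)
  have h4 : a ≤ φ (M.node 0) := le_max_left _ _
  change ∑ j, (φ (M.right j) - φ (M.left j)) = _ at h1
  linarith

variable [NeZero N]

lemma Mesh.h_le_one (M : Mesh N) : M.h ≤ 1 :=
  ciSup_le fun j => by
    have h1 := M.zero_le_left j
    have h2 := M.right_le_one j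
    simp only [Mesh.width]
    linarith

lemma Mesh.right_sub_one (M : Mesh N) {j : Fin N} (hj : j ≠ 0) : M.right (j - 1) = M.left j := by
  refine congrArg M.node (Fin.ext ?_)
  rw [Fin.val_succ, Fin.val_castSucc, Fin.val_sub_one_of_ne_zero hj]
  have : j.val ≠ 0 := fun h => hj (Fin.ext h)
  omega

lemma Mesh.left_zero (M : Mesh N) : M.left 0 = 0 := M.node_zero

lemma Mesh.right_zero_sub_one (M : Mesh N) : M.right (0 - 1) = 1 := by
  rw [← M.node_last]
  refine congrArg M.node (Fin.ext ?_)
  obtain ⟨n, rfl⟩ := Nat.exists_eq_succ_of_ne_zero (NeZero.ne N)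
  simp

/-- At each cell either a kink is near, or the cell lies well inside an interval free of kinks. -/
lemma Mesh.exists_kink_or_gap (M : Mesh N) {S : Finset ℝ} (h0 : 0 ∈ S) (h1 : 1 ∈ S) (j : Fin N) :
    (∃ s ∈ S, s - 5 * M.h ≤ M.left j ∧ M.right j ≤ s + 5 * M.h) ∨
    ∃ a ∈ S, ∃ b ∈ S, a ≤ M.left j - 4 * M.h ∧ M.right j + 4 * M.h ≤ b ∧
      ∀ s ∈ S, s ∉ Set.Ioo a b := by
  have hh := M.h_pos
  have hw := M.width_le_h j
  have hl := M.zero_le_left j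
  have hr := M.right_le_one j
  simp only [Mesh.width] at hw
  by_cases hgood : ∀ s ∈ S, s ∉ Set.Ioo (M.left j - 4 * M.h) (M.right j + 4 * M.h)
  · right
    have hleft : 0 ≤ M.left j - 4 * M.h := by
      by_contra! hcon
      exact hgood 0 h0 ⟨hcon, by linarith [M.left_lt_right j]⟩
    have hright : M.right j + 4 * M.h ≤ 1 := by
      by_contra! hcon
      exact hgood 1 h1 ⟨by linarith [M.left_lt_right j], hcon⟩
    obtain ⟨a, ha, hamax⟩ := Finset.exists_max_image (S.filter (· ≤ M.left j - 4 * M.h)) id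
      ⟨0, Finset.mem_filter.2 ⟨h0, hleft⟩⟩
    obtain ⟨b, hb, hbmin⟩ := Finset.exists_min_image (S.filter (M.right j + 4 * M.h ≤ ·)) id
      ⟨1, Finset.mem_filter.2 ⟨h1, hright⟩⟩
    rw [Finset.mem_filter] at ha hb
    refine ⟨a, ha.1, b, hb.1, ha.2, hb.2, fun s hs hsab => hgood s hs ⟨?_, ?_⟩⟩
    · by_contra! hcon
      exact absurd (hamax s (Finset.mem_filter.2 ⟨hs, hcon⟩)) (not_le.2 hsab.1)
    · by_contra! hcon
      exact absurd (hbmin s (Finset.mem_filter.2 ⟨hs, hcon⟩)) (not_le.2 hsab.2)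
  · left
    push Not at hgood
    obtain ⟨s, hs, hs1, hs2⟩ := hgood
    exact ⟨s, hs, by linarith, by linarith⟩

/-- Errors of size `h` at the cells near kinks and of size `h ^ 2 / (b - a)` at the cells inside
a gap `(a,b)` between kinks sum up to a squared `L²` norm of size `h ^ 3`: the cells near a kink
have total length at most `10 h`, and the cells of a gap contribute
`(b - a) (h ^ 2 / (b - a)) ^ 2 ≤ h ^ 3`. -/
lemma Mesh.sum_width_mul_sq_le (M : Mesh N) {S : Finset ℝ} (h0 : 0 ∈ S) (h1 : 1 ∈ S) {A B : ℝ}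
    {E : Fin N → ℝ} (hE : ∀ j, 0 ≤ E j) (hA : ∀ j, E j ≤ A * M.h)
    (hB : ∀ j, ∀ a ∈ S, ∀ b ∈ S, a ≤ M.left j - 4 * M.h → M.right j + 4 * M.h ≤ b →
      (∀ s ∈ S, s ∉ Set.Ioo a b) → E j ≤ B * M.h ^ 2 / (b - a)) :
    ∑ j, M.width j * E j ^ 2 ≤ (10 * S.card * A ^ 2 + S.card ^ 2 * B ^ 2) * M.h ^ 3 := by
  have hh := M.h_pos
  set P : Finset (ℝ × ℝ) := (S ×ˢ S).filter fun q => M.h ≤ q.2 - q.1 with hP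
  set near : ℝ → Finset (Fin N) := fun s => Finset.univ.filter fun j =>
    s - 5 * M.h ≤ M.left j ∧ M.right j ≤ s + 5 * M.h with hnear
  set inside : ℝ × ℝ → Finset (Fin N) := fun q => Finset.univ.filter fun j =>
    q.1 ≤ M.left j ∧ M.right j ≤ q.2 with hinside
  have hpt : ∀ j, M.width j * E j ^ 2 ≤
      ∑ s ∈ S, (if j ∈ near s then M.width j * (A * M.h) ^ 2 else 0) +
      ∑ q ∈ P, (if j ∈ inside q then M.width j * (B * M.h ^ 2 / (q.2 - q.1)) ^ 2 else 0) := by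
    intro j
    have hw := (M.width_pos j).le
    have n1 : ∀ s ∈ S, 0 ≤ if j ∈ near s then M.width j * (A * M.h) ^ 2 else 0 :=
      fun s _ => by split_ifs <;> positivity
    have n2 : ∀ q ∈ P, 0 ≤
        if j ∈ inside q then M.width j * (B * M.h ^ 2 / (q.2 - q.1)) ^ 2 else 0 :=
      fun q _ => by split_ifs <;> positivity
    rcases M.exists_kink_or_gap h0 h1 j with ⟨s, hs, hs1, hs2⟩ | ⟨a, ha, b, hb, hja, hjb, hfree⟩
    · have hmem : j ∈ near s := Finset.mem_filter.2 ⟨Finset.mem_univ j, hs1, hs2⟩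
      have hle := Finset.single_le_sum n1 hs
      rw [if_pos hmem] at hle
      have := mul_le_mul_of_nonneg_left (pow_le_pow_left₀ (hE j) (hA j) 2) hw
      linarith [Finset.sum_nonneg n2]
    · have hlr := M.left_lt_right j
      have hmem : j ∈ inside (a, b) :=
        Finset.mem_filter.2 ⟨Finset.mem_univ j, by simp only; linarith, by simp only; linarith⟩
      have hq : (a, b) ∈ P :=
        Finset.mem_filter.2 ⟨Finset.mk_mem_product ha hb, by simp only; linarith⟩
      have hle := Finset.single_le_sum n2 hq
      rw [if_pos hmem] at hle
      have := mul_le_mul_of_nonneg_left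
        (pow_le_pow_left₀ (hE j) (hB j a ha b hb hja hjb hfree) 2) hw
      linarith [Finset.sum_nonneg n1]
  refine (Finset.sum_le_sum fun j _ => hpt j).trans ?_
  rw [Finset.sum_add_distrib, Finset.sum_comm, Finset.sum_comm (s := Finset.univ) (t := P), add_mul]
  refine add_le_add ?_ ?_
  · have : ∀ s ∈ S, ∑ j, (if j ∈ near s then M.width j * (A * M.h) ^ 2 else 0) ≤
        10 * A ^ 2 * M.h ^ 3 := by
      intro s _
      rw [← Finset.sum_filter, Finset.filter_mem_eq_inter, Finset.univ_inter, ← Finset.sum_mul]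
      have h2 := M.sum_width_le (near s) (a := s - 5 * M.h) (b := s + 5 * M.h) (by linarith)
        (fun j hj => (Finset.mem_filter.1 hj).2)
      have h3 := mul_le_mul_of_nonneg_right h2 (sq_nonneg (A * M.h))
      linarith
    refine (Finset.sum_le_sum this).trans_eq ?_
    rw [Finset.sum_const, nsmul_eq_mul]
    ring
  · have : ∀ q ∈ P, ∑ j, (if j ∈ inside q then
        M.width j * (B * M.h ^ 2 / (q.2 - q.1)) ^ 2 else 0) ≤ B ^ 2 * M.h ^ 3 := by
      intro q hq
      have hq' : M.h ≤ q.2 - q.1 := (Finset.mem_filter.1 hq).2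
      have hq0 : 0 < q.2 - q.1 := by linarith
      rw [← Finset.sum_filter, Finset.filter_mem_eq_inter, Finset.univ_inter, ← Finset.sum_mul]
      have h2 := M.sum_width_le (inside q) (a := q.1) (b := q.2) (by linarith)
        (fun j hj => (Finset.mem_filter.1 hj).2)
      refine (mul_le_mul_of_nonneg_right h2 (sq_nonneg _)).trans ?_
      have h3 : (q.2 - q.1) * (B * M.h ^ 2 / (q.2 - q.1)) ^ 2 =
          B ^ 2 * M.h ^ 3 * (M.h / (q.2 - q.1)) := by
        field_simp
      rw [h3]
      exact mul_le_of_le_one_right (by positivity) ((div_le_one hq0).2 hq')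
    refine (Finset.sum_le_sum this).trans ?_
    rw [Finset.sum_const, nsmul_eq_mul, mul_assoc]
    refine mul_le_mul_of_nonneg_right ?_ (by positivity)
    have h2 : P.card ≤ S.card ^ 2 := by
      rw [sq, ← Finset.card_product]
      exact Finset.card_filter_le _ _
    exact_mod_cast h2

end

/-! ### Interpolation and local consistency -/

section
variable {N : ℕ}

/-- The reference coordinates of the Gauss–Legendre interpolant of a function. -/
def meshInterp (M : Mesh N) (k : ℕ) (f : ℝ → ℝ) (j : Fin N) : ℝ[X] :=
  gaussInterp k fun r => f (M.point j r)

lemma meshInterp_mem (M : Mesh N) (k : ℕ) (f : ℝ → ℝ) : meshInterp M k f ∈ DGSpace N k :=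
  fun _ => natDegree_gaussInterp k _

lemma eval_meshInterp (M : Mesh N) {k : ℕ} (f : ℝ → ℝ) (j : Fin N) {r : ℝ}
    (hr : r ∈ gaussNodes k) : (meshInterp M k f j).eval r = f (M.point j r) :=
  eval_gaussInterp _ hr

lemma Mesh.left_le_point (M : Mesh N) (j : Fin N) {r : ℝ} (hr : 0 ≤ r) :
    M.left j ≤ M.point j r :=
  le_add_of_nonneg_right (mul_nonneg (M.width_pos j).le hr)

lemma Mesh.point_le_right (M : Mesh N) (j : Fin N) {r : ℝ} (hr : r ≤ 1) :
    M.point j r ≤ M.right j := by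
  rw [← M.point_one]
  exact add_le_add le_rfl (mul_le_mul_of_nonneg_left hr (M.width_pos j).le)

lemma Mesh.right_le_left_add_h (M : Mesh N) (j : Fin N) : M.right j ≤ M.left j + M.h := by
  have := M.width_le_h j
  simp only [Mesh.width] at this
  linarith

/-- Being close to a polynomial at the Gauss–Legendre points of a cell and of its three left
neighbours, a function is evolved by a step approximately as the polynomial. -/
lemma abs_eval_rkMap_meshInterp_sub_le [NeZero N] {M : Mesh N} {k : ℕ} {c Δt K : ℝ}
    (hK : EvalBound k K) (hloc : StepLocallyBounded M k c Δt)
    {f : ℝ → ℝ} {P : Fin N → ℝ[X]} (hP : P ∈ DGSpace N k) {j : Fin N} {ε : ℝ} (hε : 0 ≤ ε)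
    (hclose : ∀ i, i = j ∨ i = j - 1 ∨ i = j - 1 - 1 ∨ i = j - 1 - 1 - 1 →
      ∀ r ∈ gaussNodes k, |f (M.point i r) - (P i).eval r| ≤ ε) {r : ℝ}
    (hr : r ∈ gaussNodes k) :
    |(rkMap (schemeOp M k c Δt) (meshInterp M k f) j).eval r -
      (rkMap (schemeOp M k c Δt) P j).eval r| ≤ K * (3 * ε) := by
  have hmem : meshInterp M k f - P ∈ DGSpace N k :=
    (dgSubmodule N k).sub_mem (meshInterp_mem M k f) hP
  have hcell : ∀ i, i = j ∨ i = j - 1 ∨ i = j - 1 - 1 ∨ i = j - 1 - 1 - 1 →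
      ‖gaussVec k ((meshInterp M k f - P) i)‖ ≤ ε := fun i hi => by
    refine norm_gaussVec_le hε fun s hs => ?_
    rw [Pi.sub_apply, eval_sub, eval_meshInterp M f i hs]
    exact hclose i hi s hs
  have h1 := hloc _ hmem j ε (hcell _ (by simp)) (hcell _ (by simp)) (hcell _ (by simp))
    (hcell _ (by simp))
  have h2 := hK.2 _ (rkMap_mem (fun i => c * Δt / M.width i) hmem j) r
    (Set.Ioo_subset_Icc_self (gaussNodes_mem_Ioo hr))
  rw [map_sub, Pi.sub_apply] at h1 h2
  rw [eval_sub] at h2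
  exact h2.trans (mul_le_mul_of_nonneg_left h1 hK.1)

section Lipschitz
variable [NeZero N]

/-- The two one-sided limits at a cell interface agree, also at the interface where the cyclic index
wraps around the period. -/
lemma Mesh.apply_right_sub_one {f : ℝ → ℝ} (hper : Function.Periodic f 1) (M : Mesh N)
    (j : Fin N) : f (M.right (j - 1)) = f (M.left j) := by
  rcases eq_or_ne j 0 with rfl | hj
  · rw [M.right_zero_sub_one, M.left_zero]
    simpa using hper 0
  · rw [M.right_sub_one hj]

lemma abs_apply_point_sub_le {M : Mesh N} {f : ℝ → ℝ} {L : ℝ} (hL : 0 ≤ L)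
    (hf : ∀ x y, |x - y| ≤ 1 → |f x - f y| ≤ L * |x - y|) (j : Fin N) {r : ℝ}
    (hr : r ∈ Set.Icc (0 : ℝ) 1) : |f (M.point j r) - f (M.left j)| ≤ L * M.h := by
  have h1 := M.left_le_point j hr.1
  have h2 := M.point_le_right j hr.2
  have h3 := M.right_le_left_add_h j
  have h4 : |M.point j r - M.left j| ≤ M.h := by
    rw [abs_le]; constructor <;> linarith [M.h_pos]
  exact (hf _ _ (h4.trans M.h_le_one)).trans (mul_le_mul_of_nonneg_left h4 hL)

lemma abs_apply_left_sub_le {M : Mesh N} {f : ℝ → ℝ} {L : ℝ} (hL : 0 ≤ L)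
    (hper : Function.Periodic f 1)
    (hf : ∀ x y, |x - y| ≤ 1 → |f x - f y| ≤ L * |x - y|) (j : Fin N) :
    |f (M.left (j - 1)) - f (M.left j)| ≤ L * M.h := by
  have := abs_apply_point_sub_le (M := M) hL hf (j - 1) (r := 1) ⟨zero_le_one, le_rfl⟩
  rw [M.point_one, M.apply_right_sub_one hper, abs_sub_comm] at this
  exact this

/-- For a Lipschitz function a step is consistent with the translation to first order. -/
lemma abs_rkMap_meshInterp_sub_le_lipschitz {M : Mesh N} {k : ℕ} {c Δt K : ℝ} (hK : EvalBound k K)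
    (hloc : StepLocallyBounded M k c Δt)
    (hcs0 : 0 ≤ c * Δt) (hcs : c * Δt ≤ M.h) {f : ℝ → ℝ} {L : ℝ} (hL : 0 ≤ L)
    (hper : Function.Periodic f 1)
    (hf : ∀ x y, |x - y| ≤ 1 → |f x - f y| ≤ L * |x - y|) (j : Fin N) {r : ℝ}
    (hr : r ∈ gaussNodes k) :
    |(rkMap (schemeOp M k c Δt) (meshInterp M k f) j).eval r - f (M.point j r - c * Δt)| ≤
      (12 * K + 1) * L * M.h := by
  have hh := M.h_pos
  have hLh : 0 ≤ L * M.h := by positivity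
  set P : Fin N → ℝ[X] := fun _ => C (f (M.left j)) with hPdef
  have hPmem : P ∈ DGSpace N k := fun _ => by simp [hPdef]
  have hrk : rkMap (schemeOp M k c Δt) P j = P j := by
    rw [rkMap_dgOp_eq_of_affine (d := 0)] <;> simp [hPdef]
  have d1 := abs_le.1 (abs_apply_left_sub_le (M := M) hL hper hf j)
  have d2 := abs_le.1 (abs_apply_left_sub_le (M := M) hL hper hf (j - 1))
  have d3 := abs_le.1 (abs_apply_left_sub_le (M := M) hL hper hf (j - 1 - 1))
  have h1 := abs_eval_rkMap_meshInterp_sub_le hK hloc hPmem (f := f) (j := j)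
    (ε := 4 * (L * M.h)) (by positivity) (fun i hi s hs => by
      have h2 := abs_le.1 (abs_apply_point_sub_le (M := M) hL hf i
        (Set.Ioo_subset_Icc_self (gaussNodes_mem_Ioo hs)))
      simp only [hPdef, eval_C]
      rw [abs_le]
      rcases hi with rfl | rfl | rfl | rfl <;> constructor <;> linarith [h2.1, h2.2, d1.1, d1.2,
        d2.1, d2.2, d3.1, d3.2]) hr
  rw [hrk] at h1
  simp only [hPdef, eval_C] at h1
  have h3 : |f (M.left j) - f (M.point j r - c * Δt)| ≤ L * M.h := by
    have hr' := gaussNodes_mem_Ioo hr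
    have h4 := M.left_le_point j hr'.1.le
    have h5 := M.point_le_right j hr'.2.le
    have h6 := M.right_le_left_add_h j
    have h7 : |M.left j - (M.point j r - c * Δt)| ≤ M.h := by
      rw [abs_le]; constructor <;> linarith
    exact (hf _ _ (h7.trans M.h_le_one)).trans (mul_le_mul_of_nonneg_left h7 hL)
  have h8 := abs_sub_le ((rkMap (schemeOp M k c Δt) (meshInterp M k f) j).eval r)
    (f (M.left j)) (f (M.point j r - c * Δt))
  linarith

/-- The Gauss–Legendre interpolant of a Lipschitz function is accurate to first order. -/
lemma abs_meshInterp_sub_le {M : Mesh N} {k : ℕ} {K : ℝ} (hK : EvalBound k K)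
    {f : ℝ → ℝ} {L : ℝ} (hL : 0 ≤ L) (hf : ∀ x y, |x - y| ≤ 1 → |f x - f y| ≤ L * |x - y|)
    (j : Fin N) {r : ℝ} (hr : r ∈ Set.Icc (0 : ℝ) 1) :
    |(meshInterp M k f j).eval r - f (M.point j r)| ≤ (K + 1) * L * M.h := by
  have h1 : ‖gaussVec k (meshInterp M k f j - C (f (M.left j)))‖ ≤ L * M.h := by
    refine norm_gaussVec_le (mul_nonneg hL M.h_pos.le) fun s hs => ?_
    rw [eval_sub, eval_meshInterp M f j hs, eval_C]
    exact abs_apply_point_sub_le hL hf j (Set.Ioo_subset_Icc_self (gaussNodes_mem_Ioo hs))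
  have h2 := hK.2 (meshInterp M k f j - C (f (M.left j)))
    ((natDegree_sub_C).trans_le (meshInterp_mem M k f j)) r hr
  rw [eval_sub, eval_C] at h2
  have h3 := abs_apply_point_sub_le (M := M) hL hf j hr
  rw [abs_sub_comm] at h3
  have h4 := abs_sub_le ((meshInterp M k f j).eval r) (f (M.left j)) (f (M.point j r))
  have h5 := mul_le_mul_of_nonneg_left h1 hK.1
  linarith

end Lipschitz

/-- Where a function is close to its tangents, a step is consistent with the translation to
second order: it transports affine functions exactly. -/
lemma abs_rkMap_meshInterp_sub_le_sq [NeZero N] {M : Mesh N} {k : ℕ} (hk : 1 ≤ k) {c Δt K : ℝ}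
    (hK : EvalBound k K)
    (hloc : StepLocallyBounded M k c Δt)
    (hcs0 : 0 ≤ c * Δt) (hcs : c * Δt ≤ M.h) {f : ℝ → ℝ} {a b B : ℝ} (hB : 0 ≤ B)
    (hT : TangentBound f a b B) (ha : 0 ≤ a) {j : Fin N} (hja : a ≤ M.left j - 4 * M.h)
    (hjb : M.right j + 4 * M.h ≤ b) {r : ℝ} (hr : r ∈ gaussNodes k) :
    |(rkMap (schemeOp M k c Δt) (meshInterp M k f) j).eval r - f (M.point j r - c * Δt)| ≤
      (27 * K + 1) * B * M.h ^ 2 := by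
  have hh := M.h_pos
  set y := M.left j with hy
  have hlr := M.left_lt_right j
  have hyI : y ∈ Set.Ioo a b := ⟨by linarith, by linarith⟩
  set β := deriv f y with hβ
  set P : Fin N → ℝ[X] := fun i => C (f y + β * (M.left i - y)) + C (β * M.width i) * X with hPdef
  have hPmem : P ∈ DGSpace N k := fun i => by
    refine le_trans ?_ hk
    simp only [hPdef]
    compute_degree
  have hPeval : ∀ i s, (P i).eval s = f y + β * (M.point i s - y) := fun i s => by
    simp only [hPdef, eval_add, eval_C, eval_mul, eval_X, Mesh.point]
    ring
  -- the four cells lie next to each other, without wrapping around the period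
  have hcontig : ∀ i, 0 < M.left i → M.right (i - 1) = M.left i := fun i hi =>
    M.right_sub_one (by rintro rfl; exact hi.ne' M.left_zero)
  have hback : ∀ i, 0 < M.left i → M.left i - M.h ≤ M.left (i - 1) := fun i hi => by
    have := M.right_le_left_add_h (i - 1)
    rw [hcontig i hi] at this
    linarith
  have l0 : 0 < M.left j := by linarith
  have l1 := hback j l0
  have l1' : 0 < M.left (j - 1) := by linarith
  have l2 := hback _ l1'
  have l2' : 0 < M.left (j - 1 - 1) := by linarith
  have l3 := hback _ l2'
  have r1 := hcontig j l0
  have r2 := hcontig _ l1'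
  have r3 := hcontig _ l2'
  have m1 := M.left_lt_right (j - 1)
  have m2 := M.left_lt_right (j - 1 - 1)
  have m3 := M.left_lt_right (j - 1 - 1 - 1)
  have hjump : ∀ i, M.right (i - 1) = M.left i → (P (i - 1)).eval 1 = (P i).eval 0 := fun i hi => by
    rw [hPeval, hPeval, M.point_one, M.point_zero, hi]
  have hderiv : ∀ i, (c * Δt / M.width i) • derivative (P i) = C (c * Δt * β) := fun i => by
    have := (M.width_pos i).ne'
    simp only [hPdef, derivative_add, derivative_C, derivative_C_mul, derivative_X, mul_one,
      zero_add, smul_C, smul_eq_mul]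
    congr 1
    field_simp
  have hrk : rkMap (schemeOp M k c Δt) P j = P j - C (c * Δt * β) :=
    rkMap_dgOp_eq_of_affine (hderiv _) (hderiv _) (hderiv _) (hjump _ r1) (hjump _ r2) (hjump _ r3)
  have hR := M.right_le_left_add_h j
  have htan : ∀ x, y - 3 * M.h ≤ x → x ≤ y + M.h → x < b →
      |f x - (f y + β * (x - y))| ≤ B * (9 * M.h ^ 2) := by
    intro x hx1 hx2 hx3
    have h1 := (hT y hyI).2 x ⟨by linarith, hx3⟩
    rw [sub_sub] at h1
    refine h1.trans (mul_le_mul_of_nonneg_left ?_ hB)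
    nlinarith
  have h1 := abs_eval_rkMap_meshInterp_sub_le hK hloc hPmem (f := f) (j := j)
    (ε := B * (9 * M.h ^ 2)) (by positivity) (fun i hi s hs => by
      have hs' := gaussNodes_mem_Ioo hs
      have h2 := M.left_le_point i hs'.1.le
      have h3 := M.point_le_right i hs'.2.le
      rw [hPeval]
      rcases hi with rfl | rfl | rfl | rfl <;> refine htan _ ?_ ?_ ?_ <;> linarith) hr
  rw [hrk, eval_sub, hPeval, eval_C] at h1
  have hr' := gaussNodes_mem_Ioo hr
  have h4 := M.left_le_point j hr'.1.le
  have h5 := M.point_le_right j hr'.2.le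
  have h6 := (hT y hyI).2 (M.point j r - c * Δt) ⟨by linarith, by linarith⟩
  have h7 : B * (M.point j r - c * Δt - y) ^ 2 ≤ B * M.h ^ 2 := by
    refine mul_le_mul_of_nonneg_left (sq_le_sq' ?_ ?_) hB <;> linarith
  have h8 := abs_le.1 h1
  have h9 := abs_le.1 (h6.trans h7)
  rw [abs_le]
  constructor <;> linarith [h8.1, h8.2, h9.1, h9.2]

end

/-! ### The error of one time step -/

lemma norm_meshVec_le_add {N : ℕ} (M : Mesh N) (k : ℕ) {D Y : Fin N → ℝ[X]} {E : Fin N → ℝ}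
    (h : ∀ j, ∀ r ∈ gaussNodes k, |(D j).eval r| ≤ |(Y j).eval r| + E j) :
    ‖meshVec M k D‖ ≤ ‖meshVec M k Y‖ + √(∑ j, M.width j * E j ^ 2) := by
  let y : EuclideanSpace ℝ (Fin N × gaussNodes k) := WithLp.toLp 2 fun i => |meshVec M k Y i|
  let e : EuclideanSpace ℝ (Fin N × gaussNodes k) :=
    WithLp.toLp 2 fun i => √(M.width i.1) * √(gaussWeight k i.2) * E i.1
  have hy : ‖y‖ = ‖meshVec M k Y‖ := by
    rw [EuclideanSpace.norm_eq, EuclideanSpace.norm_eq]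
    simp [y]
  have he : ‖e‖ = √(∑ j, M.width j * E j ^ 2) := by
    rw [EuclideanSpace.norm_eq, Fintype.sum_prod_type]
    congr 1
    refine Finset.sum_congr rfl fun j _ => ?_
    have h1 : ∀ r : gaussNodes k, ‖e (j, r)‖ ^ 2 = gaussWeight k r * (M.width j * E j ^ 2) := by
      intro r
      simp only [e, Real.norm_eq_abs, sq_abs, mul_pow]
      rw [Real.sq_sqrt (M.width_pos j).le, Real.sq_sqrt (gaussWeight_pos r.2).le]
      ring
    rw [Finset.sum_congr rfl fun r _ => h1 r, ← Finset.sum_mul,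
      Finset.sum_coe_sort (gaussNodes k) (gaussWeight k), sum_gaussWeight, one_mul]
  have hle : ‖meshVec M k D‖ ≤ ‖y + e‖ := by
    rw [EuclideanSpace.norm_eq, EuclideanSpace.norm_eq]
    refine Real.sqrt_le_sqrt (Finset.sum_le_sum fun i _ => ?_)
    refine pow_le_pow_left₀ (norm_nonneg _) ?_ 2
    have h1 := mul_le_mul_of_nonneg_left (h i.1 i.2 i.2.2)
      (mul_nonneg (Real.sqrt_nonneg (M.width i.1)) (Real.sqrt_nonneg (gaussWeight k i.2)))
    have h2 : ‖meshVec M k D i‖ =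
        √(M.width i.1) * √(gaussWeight k i.2) * |(D i.1).eval (i.2 : ℝ)| := by
      rw [meshVec_apply, gaussVec_apply, Real.norm_eq_abs, abs_mul, abs_mul,
        abs_of_nonneg (Real.sqrt_nonneg _), abs_of_nonneg (Real.sqrt_nonneg _), mul_assoc]
    have h3 : (y + e) i = √(M.width i.1) * √(gaussWeight k i.2) *
        (|(Y i.1).eval (i.2 : ℝ)| + E i.1) := by
      simp only [y, e, PiLp.add_apply, meshVec_apply, gaussVec_apply]
      rw [abs_mul, abs_mul, abs_of_nonneg (Real.sqrt_nonneg _),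
        abs_of_nonneg (Real.sqrt_nonneg _)]
      ring
    rw [h2]
    refine h1.trans ?_
    rw [← h3]
    exact Real.le_norm_self _
  rw [← hy, ← he]
  exact hle.trans (norm_add_le _ _)

/-- A step of the scheme increases the `L²` distance to the interpolant of the exact solution by
at most a multiple of `h ^ (3/2)`. Here `f` and `v` are the exact solution before and after the
step, `Q` and `Q'` the numerical solution in reference coordinates. -/
theorem exists_step_error {k : ℕ} (hk : 1 ≤ k) {K : ℝ} (hK : EvalBound k K) {m : ℕ} (hm : 2 ≤ m)
    (p : ℕ) {L : ℝ} (hL : 0 ≤ L) (c₀ : ℝ) : ∃ C : ℝ, 0 ≤ C ∧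
    ∀ (N : ℕ) [NeZero N] (M : Mesh N) (c Δt : ℝ) (f v g gt : ℝ → ℝ), 0 < c → 0 < Δt →
      (∀ j, c * Δt ≤ M.width j) →
      (∀ Q ∈ DGSpace N k, ‖meshVec M k (rkMap (schemeOp M k c Δt) Q)‖ ≤ ‖meshVec M k Q‖) →
      StepLocallyBounded M k c Δt → Continuous g → (∀ x, g x ≤ f x) →
      (∀ x, v x = max (f (x - c * Δt)) (maxObstacle c g Δt x)) →
      (gt = maxObstacle c g Δt ∨ gt = twoPointObstacle c g Δt) →
      Continuous f → Function.Periodic f 1 → PiecewiseRegular m p L c₀ f →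
      PiecewiseRegular m p L c₀ v →
      ∀ Q ∈ DGSpace N k, ∀ Q' : Fin N → ℝ[X],
        (∀ j, ∀ r ∈ gaussNodes k, (Q' j).eval r =
          max ((rkMap (schemeOp M k c Δt) Q j).eval r) (gt (M.point j r))) →
        ‖meshVec M k (Q' - meshInterp M k v)‖ ≤
          ‖meshVec M k (Q - meshInterp M k f)‖ + C * (M.h * √M.h) := by
  obtain ⟨C₁, hC₁, htan⟩ := PiecewiseRegular.exists_tangentBound (p := p) hm hL c₀
  have hK0 := hK.1
  set A : ℝ := (k + 1) * ((12 * K + 1) * L + L) with hA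
  set B : ℝ := (k + 1) * ((27 * K + 1) + 6) * C₁ with hB
  set q : ℝ := 2 * p + 2 with hq
  refine ⟨√(10 * q * A ^ 2 + q ^ 2 * B ^ 2), Real.sqrt_nonneg _, ?_⟩
  intro N _ M c Δt f v g gt hc hΔt hwidth hcontr hloc hg hgf hdpp hgt hfc hfper hfreg hvreg Q hQ
    Q' hQ'
  have hh := M.h_pos
  have hcs0 : 0 < c * Δt := mul_pos hc hΔt
  have hcs : c * Δt ≤ M.h := (hwidth 0).trans (M.width_le_h 0)
  have hfLip := abs_sub_le_of_periodic hfc hfper hfreg.1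
  obtain ⟨Sf, hSf, hTf⟩ := htan f hfreg
  obtain ⟨Sv, hSv, hTv⟩ := htan v hvreg
  -- the ends of the period count as kinks: regularity across them is not assumed
  set S : Finset ℝ := (Sf ∪ Sv) ∪ {0, 1} with hS
  have hScard : (S.card : ℝ) ≤ q := by
    have h1 : S.card ≤ (Sf ∪ Sv).card + ({0, 1} : Finset ℝ).card := Finset.card_union_le _ _
    have h2 := Finset.card_union_le Sf Sv
    have h3 := Finset.card_le_two (a := (0 : ℝ)) (b := 1)
    have : S.card ≤ 2 * p + 2 := by omega
    rw [hq]
    exact_mod_cast this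
  have h0S : (0 : ℝ) ∈ S := by simp [hS]
  have h1S : (1 : ℝ) ∈ S := by simp [hS]
  set F : Fin N → ℝ → ℝ := fun j r => (rkMap (schemeOp M k c Δt) (meshInterp M k f) j).eval r
    - f (M.point j r - c * Δt) with hF
  set G : Fin N → ℝ → ℝ := fun j r => v (M.point j r) -
    max (f (M.point j r - c * Δt)) (gt (M.point j r)) with hG
  have hG0 : ∀ j r, 0 ≤ G j r := fun j r =>
    sub_nonneg.2 (max_obstacle_le hg hΔt.le hdpp hgt _)
  -- the sum over the `k + 1` points stands in for the maximum over the cell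
  set E : Fin N → ℝ := fun j => ∑ r ∈ gaussNodes k, (|F j r| + G j r) with hE
  have hterm0 : ∀ j r, 0 ≤ |F j r| + G j r := fun j r => add_nonneg (abs_nonneg _) (hG0 j r)
  have hE0 : ∀ j, 0 ≤ E j := fun j => Finset.sum_nonneg fun r _ => hterm0 j r
  have hEle : ∀ j (t : ℝ), (∀ r ∈ gaussNodes k, |F j r| + G j r ≤ t) → E j ≤ (k + 1) * t := by
    intro j t ht
    refine (Finset.sum_le_sum ht).trans_eq ?_
    rw [Finset.sum_const, card_gaussNodes, nsmul_eq_mul]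
    push_cast
    ring
  have hEA : ∀ j, E j ≤ A * M.h := by
    intro j
    rw [hA, mul_assoc]
    refine hEle j _ fun r hr => ?_
    have h1 := abs_rkMap_meshInterp_sub_le_lipschitz hK hloc hcs0.le hcs hL hfper hfLip j hr
    have h2 := sub_max_obstacle_le_lipschitz (gt := gt) hc.le hg hΔt.le hgf hdpp hL
      (hcs.trans M.h_le_one) hfLip (M.point j r)
    have h3 := mul_le_mul_of_nonneg_left hcs hL
    simp only [hF, hG]
    linarith
  have hEB : ∀ j, ∀ a ∈ S, ∀ b ∈ S, a ≤ M.left j - 4 * M.h → M.right j + 4 * M.h ≤ b →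
      (∀ s ∈ S, s ∉ Set.Ioo a b) → E j ≤ B * M.h ^ 2 / (b - a) := by
    intro j a _ b _ hja hjb hfree
    have hlr := M.left_lt_right j
    have hl0 := M.zero_le_left j
    have hr1 := M.right_le_one j
    have ha0 : 0 ≤ a := by
      by_contra! hcon
      exact hfree 0 h0S ⟨hcon, by linarith⟩
    have hb1 : b ≤ 1 := by
      by_contra! hcon
      exact hfree 1 h1S ⟨by linarith, hcon⟩
    have hab : a < b := by linarith
    have hTf' := hTf a b ha0 hab hb1 fun s hs => hfree s (by simp [hS, hs])
    have hTv' := hTv a b ha0 hab hb1 fun s hs => hfree s (by simp [hS, hs])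
    have hM0 : 0 ≤ C₁ / (b - a) := div_nonneg hC₁ (by linarith)
    have hBeq : B * M.h ^ 2 / (b - a) =
        (k + 1) * (((27 * K + 1) + 6) * (C₁ / (b - a)) * M.h ^ 2) := by
      rw [hB]; ring
    rw [hBeq]
    refine hEle j _ fun r hr => ?_
    have hr' := gaussNodes_mem_Ioo hr
    have h4 := M.left_le_point j hr'.1.le
    have h5 := M.point_le_right j hr'.2.le
    have h1 := abs_rkMap_meshInterp_sub_le_sq hk hK hloc hcs0.le hcs hM0 hTf' ha0 hja hjb hr
    have h2 := sub_max_obstacle_le_sq (x := M.point j r) hc hg hΔt.le hgf hdpp hgt hM0 hTf' hTv'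
      (by linarith) (by linarith)
    have h3 : 6 * (C₁ / (b - a)) * (c * Δt) ^ 2 ≤ 6 * (C₁ / (b - a)) * M.h ^ 2 :=
      mul_le_mul_of_nonneg_left (pow_le_pow_left₀ hcs0.le hcs 2) (by positivity)
    simp only [hF, hG]
    linarith
  have hsum := M.sum_width_mul_sq_le h0S h1S hE0 hEA hEB
  have hsqrt : √(∑ j, M.width j * E j ^ 2) ≤
      √(10 * q * A ^ 2 + q ^ 2 * B ^ 2) * (M.h * √M.h) := by
    have h1 : M.h * √M.h = √(M.h ^ 3) := by
      rw [show M.h ^ 3 = M.h ^ 2 * M.h by ring, Real.sqrt_mul (by positivity),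
        Real.sqrt_sq hh.le]
    rw [h1, ← Real.sqrt_mul (by positivity)]
    refine Real.sqrt_le_sqrt (hsum.trans (mul_le_mul_of_nonneg_right ?_ (by positivity)))
    gcongr
  set e := rkMap (schemeOp M k c Δt) (Q - meshInterp M k f) with he
  have hpt : ∀ j, ∀ r ∈ gaussNodes k,
      |((Q' - meshInterp M k v) j).eval r| ≤ |(e j).eval r| + E j := by
    intro j r hr
    have h1 : |F j r| + G j r ≤ E j :=
      Finset.single_le_sum (f := fun r => |F j r| + G j r) (fun r _ => hterm0 j r) hr
    refine le_trans ?_ (add_le_add le_rfl h1)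
    rw [Pi.sub_apply, eval_sub, eval_meshInterp M v j hr, hQ' j r hr]
    have h2 : (rkMap (schemeOp M k c Δt) Q j).eval r - f (M.point j r - c * Δt) =
        (e j).eval r + F j r := by
      simp only [he, hF, map_sub, Pi.sub_apply, eval_sub]
      ring
    -- the maximum with the obstacle value is nonexpansive
    have h3 := abs_max_sub_max_le_abs ((rkMap (schemeOp M k c Δt) Q j).eval r)
      (f (M.point j r - c * Δt)) (gt (M.point j r))
    rw [h2] at h3
    have h4 := abs_add_le ((e j).eval r) (F j r)
    have h5 := abs_sub_le (max ((rkMap (schemeOp M k c Δt) Q j).eval r) (gt (M.point j r)))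
      (max (f (M.point j r - c * Δt)) (gt (M.point j r))) (v (M.point j r))
    have h6 : |max (f (M.point j r - c * Δt)) (gt (M.point j r)) - v (M.point j r)| = G j r := by
      rw [abs_sub_comm, abs_of_nonneg (hG0 j r)]
    linarith
  refine (norm_meshVec_le_add M k hpt).trans (add_le_add ?_ hsqrt)
  exact hcontr _ ((dgSubmodule N k).sub_mem hQ (meshInterp_mem M k f))

/-! ### Initial error and the `L²` error -/

/-- The distance of the `L²` projection to the interpolant is at most that of the function, by
best approximation. -/
lemma norm_meshVec_projection_sub_le {N : ℕ} {M : Mesh N} {k : ℕ} {f : ℝ → ℝ} (hf : Continuous f)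
    {v : Fin N → ℝ[X]} (hv : IsL2Projection M k f v) {ε : ℝ} (hε : 0 ≤ ε)
    (happrox : ∀ j, ∀ r ∈ Set.Icc (0 : ℝ) 1,
      |(meshInterp M k f j).eval r - f (M.point j r)| ≤ ε) :
    ‖meshVec M k (toRef M v - meshInterp M k f)‖ ≤ ε := by
  set I := meshInterp M k f with hI
  set e := toRef M v - I with he
  have heD : e ∈ DGSpace N k :=
    (dgSubmodule N k).sub_mem (toRef_mem M hv.1) (meshInterp_mem M k f)
  have horth := hv.2 (ofRef M e) (ofRef_mem M heD)
  rw [l2Inner_eq, toRef_ofRef] at horth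
  have hcont : ∀ j, Continuous fun r => f (M.point j r) := fun j =>
    hf.comp (by unfold Mesh.point; fun_prop)
  have hfun : l2InnerFun M f (ofRef M e) =
      ∑ j, M.width j * ∫ r in (0 : ℝ)..1, f (M.point j r) * (e j).eval r := by
    refine Finset.sum_congr rfl fun j _ => ?_
    rw [M.integral_eq]
    simp only [← eval_toRef, toRef_ofRef]
  rw [hfun] at horth
  have hcell : ∀ j, M.width j * unitInt (e j * e j) ≤
      M.width j * unitInt (toRef M v j * e j) -
      M.width j * (∫ r in (0 : ℝ)..1, f (M.point j r) * (e j).eval r) +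
      M.width j * ((ε ^ 2 + unitInt (e j * e j)) / 2) := by
    intro j
    have h1 : unitInt (e j * e j) = unitInt (toRef M v j * e j) - unitInt (I j * e j) := by
      rw [← map_sub, ← sub_mul]; rfl
    have h2 : (∫ r in (0 : ℝ)..1, f (M.point j r) * (e j).eval r) - unitInt (I j * e j) ≤
        (ε ^ 2 + unitInt (e j * e j)) / 2 := by
      have hsplit : (ε ^ 2 + unitInt (e j * e j)) / 2 =
          ∫ r in (0 : ℝ)..1, (ε ^ 2 + (e j * e j).eval r) / 2 := by
        rw [intervalIntegral.integral_div, intervalIntegral.integral_add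
          (by simp) ((e j * e j).continuous.intervalIntegrable _ _), unitInt_apply]
        simp
      have hi : IntervalIntegrable (fun r => f (M.point j r) * (e j).eval r)
          MeasureTheory.volume 0 1 :=
        ((hcont j).mul (e j).continuous).intervalIntegrable _ _
      have hi' := (I j * e j).continuous.intervalIntegrable (μ := MeasureTheory.volume) 0 1
      rw [hsplit, unitInt_apply, ← intervalIntegral.integral_sub hi hi']
      refine intervalIntegral.integral_mono_on zero_le_one (hi.sub hi')
        (((continuous_const.add (e j * e j).continuous).div_const 2).intervalIntegrable _ _)
        fun r hr => ?_
      have h3 := abs_le.1 (happrox j r hr)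
      have h4 : ((I j).eval r - f (M.point j r)) ^ 2 ≤ ε ^ 2 := sq_le_sq' h3.1 h3.2
      simp only [eval_mul]
      nlinarith [sq_nonneg ((I j).eval r - f (M.point j r) + (e j).eval r)]
    have hw := (M.width_pos j).le
    have h3 := mul_le_mul_of_nonneg_left h2 hw
    have h4 : M.width j * unitInt (e j * e j) =
        M.width j * (unitInt (toRef M v j * e j) - unitInt (I j * e j)) := by rw [← h1]
    linarith
  have htotal := Finset.sum_le_sum fun j (_ : j ∈ Finset.univ) => hcell j
  rw [Finset.sum_add_distrib, Finset.sum_sub_distrib, horth, sub_self, zero_add] at htotal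
  have hnorm : ‖meshVec M k e‖ ^ 2 = ∑ j, M.width j * unitInt (e j * e j) := by
    rw [norm_meshVec_sq]
    exact Finset.sum_congr rfl fun j _ => by rw [norm_gaussVec_sq_eq_unitInt (heD j)]
  have hsplit : ∑ j, M.width j * ((ε ^ 2 + unitInt (e j * e j)) / 2) =
      (ε ^ 2 + ∑ j, M.width j * unitInt (e j * e j)) / 2 := by
    have h1 : ∀ j, M.width j * ((ε ^ 2 + unitInt (e j * e j)) / 2) =
        (M.width j * ε ^ 2 + M.width j * unitInt (e j * e j)) / 2 := fun j => by ring
    rw [Finset.sum_congr rfl fun j _ => h1 j, ← Finset.sum_div, Finset.sum_add_distrib,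
      ← Finset.sum_mul, M.sum_width, one_mul]
  rw [hsplit, ← hnorm] at htotal
  exact abs_le_of_sq_le_sq' (by linarith) hε |>.2

/-- The `L²` error is controlled by the distance to the interpolant and the interpolation error. -/
lemma l2Error_le {N : ℕ} {M : Mesh N} {k : ℕ} {f : ℝ → ℝ} (hf : Continuous f) {v : Fin N → ℝ[X]}
    (hv : v ∈ DGSpace N k) {ε : ℝ} (hε : 0 ≤ ε)
    (happrox : ∀ j, ∀ r ∈ Set.Icc (0 : ℝ) 1,
      |(meshInterp M k f j).eval r - f (M.point j r)| ≤ ε) :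
    l2Error M v f ≤ 2 * (‖meshVec M k (toRef M v - meshInterp M k f)‖ + ε) := by
  set I := meshInterp M k f with hI
  set e := toRef M v - I with he
  have heD : e ∈ DGSpace N k :=
    (dgSubmodule N k).sub_mem (toRef_mem M hv) (meshInterp_mem M k f)
  have hcont : ∀ j, Continuous fun r => f (M.point j r) := fun j =>
    hf.comp (by unfold Mesh.point; fun_prop)
  have hcell : ∀ j, ∫ x in (M.left j)..(M.right j), ((v j).eval x - f x) ^ 2 ≤
      M.width j * (2 * unitInt (e j * e j) + 2 * ε ^ 2) := by
    intro j
    rw [M.integral_eq]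
    refine mul_le_mul_of_nonneg_left ?_ (M.width_pos j).le
    have hi : IntervalIntegrable (fun r => 2 * (e j * e j).eval r) MeasureTheory.volume 0 1 :=
      (continuous_const.mul (e j * e j).continuous).intervalIntegrable _ _
    have hi' : IntervalIntegrable (fun _ : ℝ => 2 * ε ^ 2) MeasureTheory.volume 0 1 := by simp
    have hsplit : 2 * unitInt (e j * e j) + 2 * ε ^ 2 =
        ∫ r in (0 : ℝ)..1, (2 * (e j * e j).eval r + 2 * ε ^ 2) := by
      rw [intervalIntegral.integral_add hi hi', intervalIntegral.integral_const_mul, unitInt_apply]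
      simp
    rw [hsplit]
    simp only [← eval_toRef]
    refine intervalIntegral.integral_mono_on zero_le_one
      ((((toRef M v j).continuous.sub (hcont j)).pow 2).intervalIntegrable _ _)
      (hi.add hi')
      fun r hr => ?_
    have h3 := abs_le.1 (happrox j r hr)
    have h4 : ((I j).eval r - f (M.point j r)) ^ 2 ≤ ε ^ 2 := sq_le_sq' h3.1 h3.2
    have h5 : (e j).eval r = (toRef M v j).eval r - (I j).eval r := by
      simp only [he, Pi.sub_apply, eval_sub]
    simp only [eval_mul, h5]
    nlinarith [sq_nonneg ((toRef M v j).eval r - (I j).eval r -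
      ((I j).eval r - f (M.point j r)))]
  have hnorm : ‖meshVec M k e‖ ^ 2 = ∑ j, M.width j * unitInt (e j * e j) := by
    rw [norm_meshVec_sq]
    exact Finset.sum_congr rfl fun j _ => by rw [norm_gaussVec_sq_eq_unitInt (heD j)]
  have hsum : ∑ j, M.width j * (2 * unitInt (e j * e j) + 2 * ε ^ 2) =
      2 * ‖meshVec M k e‖ ^ 2 + 2 * ε ^ 2 := by
    have h1 : ∀ j, M.width j * (2 * unitInt (e j * e j) + 2 * ε ^ 2) =
        2 * (M.width j * unitInt (e j * e j)) + M.width j * (2 * ε ^ 2) := fun j => by ring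
    rw [Finset.sum_congr rfl fun j _ => h1 j, Finset.sum_add_distrib, ← Finset.mul_sum,
      ← Finset.sum_mul, M.sum_width, one_mul, hnorm]
  have hn := norm_nonneg (meshVec M k e)
  rw [l2Error]
  refine Real.sqrt_le_iff.2 ⟨by positivity, ?_⟩
  refine (Finset.sum_le_sum fun j _ => hcell j).trans ?_
  rw [hsum]
  nlinarith [mul_nonneg hn hε]

/-! ### Accumulation of the errors -/

/-- The error estimate, with constants depending only on the regularity of `u`, on `T` and on the
degree. -/
theorem exists_error_bound {k : ℕ} (hk : 1 ≤ k) {c : ℝ} (hc : 0 < c) {ℓ : ℕ} (hℓ : 2 ≤ ℓ) {T : ℝ}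
    (hT : 0 ≤ T) {g u₀ : ℝ → ℝ} {u : ℝ → ℝ → ℝ} (hg : Continuous g)
    (hu : IsViscositySolution c g u₀ u) (hns : NoShattering ℓ T u) :
    ∃ C : ℝ, 0 ≤ C ∧ ∀ (N : ℕ) [NeZero N] (M : Mesh N) (Δt : ℝ) (gt : ℝ → ℝ)
      (U : ℕ → Fin N → ℝ[X]), 0 < Δt → (∀ j, c * Δt ≤ M.width j) →
      (∀ Q ∈ DGSpace N k, ‖meshVec M k (rkMap (schemeOp M k c Δt) Q)‖ ≤ ‖meshVec M k Q‖) →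
      StepLocallyBounded M k c Δt →
      (gt = maxObstacle c g Δt ∨ gt = twoPointObstacle c g Δt) →
      IsGaussRKDGScheme M k c Δt u₀ gt U → ∀ n : ℕ, n * Δt ≤ T →
        l2Error M (U n) (u (n * Δt)) ≤ C * √(M.h + M.h ^ 3 / Δt ^ 2) := by
  obtain ⟨p, L, c₀, hreg⟩ := hns
  have hL : 0 ≤ L := (hreg 0 ⟨le_rfl, hT⟩).lipschitz_const_nonneg
  obtain ⟨K, hK⟩ := exists_evalBound k
  have hK0 := hK.1
  obtain ⟨C₂, hC₂, hstep⟩ := exists_step_error hk hK (show 2 ≤ ℓ + 1 by omega) p hL c₀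
  set B := (K + 1) * L with hB
  have hB0 : 0 ≤ B := by positivity
  refine ⟨2 * (2 * B + T * C₂), by positivity, ?_⟩
  intro N _ M Δt gt U hΔt hwidth hcontr hloc hgt hU
  have hh := M.h_pos
  have hLip : ∀ t, 0 ≤ t → t ≤ T → ∀ x y, |x - y| ≤ 1 → |u t x - u t y| ≤ L * |x - y| :=
    fun t h0 h1 => abs_sub_le_of_periodic (hu.continuous_space h0) (hu.periodic t h0)
      (hreg t ⟨h0, h1⟩).1
  have happrox : ∀ t, 0 ≤ t → t ≤ T → ∀ j, ∀ r ∈ Set.Icc (0 : ℝ) 1,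
      |(meshInterp M k (u t) j).eval r - u t (M.point j r)| ≤ B * M.h :=
    fun t h0 h1 j r hr => abs_meshInterp_sub_le hK hL (hLip t h0 h1) j hr
  have hmem : ∀ n, U n ∈ DGSpace N k := fun n => by
    cases n with
    | zero => exact hU.initial.1
    | succ n => exact hU.mem n
  have hBh : 0 ≤ B * M.h := by positivity
  have hacc : ∀ n : ℕ, n * Δt ≤ T →
      ‖meshVec M k (toRef M (U n) - meshInterp M k (u (n * Δt)))‖ ≤
        B * M.h + n * (C₂ * (M.h * √M.h)) := by
    intro n
    induction n with
    | zero =>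
      intro _
      have hu0 : u 0 = u₀ := funext hu.initial
      simp only [Nat.cast_zero, zero_mul, add_zero]
      rw [hu0]
      refine norm_meshVec_projection_sub_le (hu0 ▸ hu.continuous_space le_rfl) hU.initial hBh ?_
      exact hu0 ▸ happrox 0 le_rfl hT
    | succ n ih =>
      intro hn
      push_cast at hn ⊢
      have hn0 : 0 ≤ (n : ℝ) * Δt := by positivity
      have hn' : n * Δt ≤ T := by linarith
      have hnext : ((n : ℝ) + 1) * Δt = n * Δt + Δt := by ring
      obtain ⟨w, hw, hUn⟩ := hU.step n
      have hwref := hw.toRef_eq (hmem n)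
      have h1 := hstep N M c Δt (u (n * Δt)) (u ((n + 1) * Δt)) g gt hc hΔt hwidth hcontr hloc hg
        (hu.obstacle_le hg hn0)
        (fun x => by rw [hnext]; exact hu.eq_max hg hn0 hΔt.le x) hgt
        (hu.continuous_space hn0) (hu.periodic _ hn0) (hreg _ ⟨hn0, hn'⟩)
        (hreg _ ⟨by rw [hnext]; linarith, hn⟩) (toRef M (U n)) (toRef_mem M (hmem n))
        (toRef M (U (n + 1))) (fun j r hr => by
          rw [← hwref, eval_toRef, eval_toRef]
          exact hUn j r (mem_gaussPoints_iff.2 hr))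
      have h2 := ih hn'
      linarith
  intro n hn
  have hn0 : 0 ≤ (n : ℝ) * Δt := by positivity
  have h1 := l2Error_le (hu.continuous_space hn0) (hmem n) hBh (happrox _ hn0 hn)
  have h2 := hacc n hn
  set R := √(M.h + M.h ^ 3 / Δt ^ 2) with hR
  have hR0 : 0 ≤ R := Real.sqrt_nonneg _
  have h3 : M.h ≤ R := by
    refine Real.le_sqrt_of_sq_le ?_
    have : M.h ^ 2 ≤ M.h := by nlinarith [M.h_le_one]
    have : 0 ≤ M.h ^ 3 / Δt ^ 2 := by positivity
    linarith
  have h4 : M.h * √M.h / Δt ≤ R := by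
    refine Real.le_sqrt_of_sq_le ?_
    have : (M.h * √M.h / Δt) ^ 2 = M.h ^ 3 / Δt ^ 2 := by
      rw [div_pow, mul_pow, Real.sq_sqrt hh.le]
      ring
    linarith
  have h5 : n * (C₂ * (M.h * √M.h)) ≤ T * C₂ * R := by
    have h6 : n * (C₂ * (M.h * √M.h)) = n * Δt * (C₂ * (M.h * √M.h / Δt)) := by
      field_simp
    rw [h6, mul_assoc T]
    exact mul_le_mul hn (mul_le_mul_of_nonneg_left h4 hC₂) (by positivity) hT
  have h7 := mul_le_mul_of_nonneg_left h3 hB0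
  linarith

end ObstacleDG

end

theorem mainTheorem4 (k : ℕ) (hk : 1 ≤ k) (c : ℝ) (hc : 0 < c) (ρ : ℝ) :
    ∃ C₀ : ℝ, 0 < C₀ ∧
      ∀ (ℓ : ℕ) (_ : 2 ≤ ℓ) (T : ℝ) (_ : 0 ≤ T) (g u₀ : ℝ → ℝ) (u : ℝ → ℝ → ℝ),
        Continuous g → Function.Periodic g 1 →
        ObstacleDG.IsViscositySolution c g u₀ u →
        ObstacleDG.NoShattering ℓ T u →
        (∃ C : ℝ, 0 ≤ C ∧
          ∀ (N : ℕ) [NeZero N] (M : ObstacleDG.Mesh N) (Δt : ℝ) (gt : ℝ → ℝ)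
            (U : ℕ → Fin N → Polynomial ℝ),
            M.QuasiUniform ρ → 0 < Δt → Δt ≤ C₀ * M.h →
            (gt = ObstacleDG.maxObstacle c g Δt ∨ gt = ObstacleDG.twoPointObstacle c g Δt) →
            ObstacleDG.IsGaussRKDGScheme M k c Δt u₀ gt U →
            ∀ n : ℕ, n * Δt ≤ T →
              ObstacleDG.l2Error M (U n) (u (n * Δt)) ≤ C * √(M.h + M.h ^ 3 / Δt ^ 2)) ∧
        (∀ Cbar : ℝ, 0 < Cbar → ∃ C₁ : ℝ, 0 ≤ C₁ ∧
          ∀ (N : ℕ) [NeZero N] (M : ObstacleDG.Mesh N) (Δt : ℝ) (gt : ℝ → ℝ)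
            (U : ℕ → Fin N → Polynomial ℝ),
            M.QuasiUniform ρ → 0 < Δt → Δt ≤ C₀ * M.h → Cbar ≤ Δt / M.h →
            (gt = ObstacleDG.maxObstacle c g Δt ∨ gt = ObstacleDG.twoPointObstacle c g Δt) →
            ObstacleDG.IsGaussRKDGScheme M k c Δt u₀ gt U →
            ∀ n : ℕ, n * Δt ≤ T →
              ObstacleDG.l2Error M (U n) (u (n * Δt)) ≤ C₁ * √M.h) := by
  obtain ⟨C₀, hC₀, hcfl⟩ := ObstacleDG.exists_cfl k hc ρ
  refine ⟨C₀, hC₀, fun ℓ hℓ T hT g u₀ u hg _ hu hns => ?_⟩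
  obtain ⟨C, hC, hbound⟩ := ObstacleDG.exists_error_bound hk hc hℓ hT hg hu hns
  refine ⟨⟨C, hC, fun N _ M Δt gt U hM hΔt hle hgt hU n hn => ?_⟩, fun Cbar hCbar =>
    ⟨C * √(1 + 1 / Cbar ^ 2), by positivity,
      fun N _ M Δt gt U hM hΔt hle hratio hgt hU n hn => ?_⟩⟩
  · obtain ⟨h1, h2, h3⟩ := hcfl N M Δt hM hΔt hle
    exact hbound N M Δt gt U hΔt h1 h2 h3 hgt hU n hn
  · obtain ⟨h1, h2, h3⟩ := hcfl N M Δt hM hΔt hle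
    refine (hbound N M Δt gt U hΔt h1 h2 h3 hgt hU n hn).trans ?_
    have hh := M.h_pos
    rw [mul_assoc, ← Real.sqrt_mul (by positivity)]
    refine mul_le_mul_of_nonneg_left (Real.sqrt_le_sqrt ?_) hC
    rw [le_div_iff₀ hh] at hratio
    have h4 : M.h ^ 3 / Δt ^ 2 ≤ M.h ^ 3 / (Cbar * M.h) ^ 2 :=
      div_le_div_of_nonneg_left (by positivity) (by positivity)
        (pow_le_pow_left₀ (by positivity) hratio 2)
    have h5 : M.h ^ 3 / (Cbar * M.h) ^ 2 = 1 / Cbar ^ 2 * M.h := by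
      field_simp
    linarith
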